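/- Let $n\ge 2$ be an integer and $m>1$ a real number. Let $(M,g)$ be a closed (compact, connected, without boundary) smooth $n$-dimensional Riemannian manifold, and let $f,\lambda: M\to\mathbb{R}$ be smooth functions such that $(M,g,f)$ is a generalized $(\lambda,n+m)$-Einstein manifold, i.e. $$D\,df=\frac{f}{m}\left(\mathrm{Ric}_g-\lambda g\right),$$ where $D\,df$ is the Hessian of $f$ and $\mathrm{Ric}_g$ the Ricci tensor of $g$. Suppose that $f$ is not identically zero and that $f^{-1}(0)\neq\emptyset$. If the scalar curvature $s$ of $g$ is constant, then $s>0$. -/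

import Mathlib

open scoped Manifold ContDiff

noncomputable section

namespace RiemCoord

/-! ### Riemannian geometry of a metric `G = (g_ij)` on (an open part of) `ℝⁿ` -/

variable {n : ℕ}

/-- The partial derivative `∂_i F` of a function on `ℝⁿ`. -/
def pd (i : Fin n) (F : EuclideanSpace ℝ (Fin n) → ℝ) (y : EuclideanSpace ℝ (Fin n)) : ℝ :=
  fderiv ℝ F y (EuclideanSpace.single i 1)

/-- Christoffel symbols of the Levi-Civita connection,
`Γ^k_ij = 1/2 ∑_l g^kl (∂_i g_jl + ∂_j g_il - ∂_l g_ij)`. -/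
def christoffel (G : EuclideanSpace ℝ (Fin n) → Matrix (Fin n) (Fin n) ℝ) (k i j : Fin n)
    (y : EuclideanSpace ℝ (Fin n)) : ℝ :=
  (1 / 2 : ℝ) * ∑ l, (G y)⁻¹ k l *
    (pd i (fun z => G z j l) y + pd j (fun z => G z i l) y - pd l (fun z => G z i j) y)

/-- The Riemann curvature tensor: `R(∂_i, ∂_j) ∂_k = ∑_l R^l_kij ∂_l`, where
`R(X, Y) Z = ∇_X ∇_Y Z - ∇_Y ∇_X Z - ∇_[X,Y] Z`. -/
def riemann (G : EuclideanSpace ℝ (Fin n) → Matrix (Fin n) (Fin n) ℝ) (l k i j : Fin n)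
    (y : EuclideanSpace ℝ (Fin n)) : ℝ :=
  pd i (christoffel G l j k) y - pd j (christoffel G l i k) y
    + ∑ p, (christoffel G l i p y * christoffel G p j k y
      - christoffel G l j p y * christoffel G p i k y)

/-- The Ricci tensor `Ric_jk = ∑_i R^i_kij`, i.e. `Ric(Y, Z) = tr (X ↦ R(X, Y) Z)`;
it is positive on round spheres. -/
def ricci (G : EuclideanSpace ℝ (Fin n) → Matrix (Fin n) (Fin n) ℝ) (j k : Fin n)
    (y : EuclideanSpace ℝ (Fin n)) : ℝ :=
  ∑ i, riemann G i k i j y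

/-- The scalar curvature `∑_jk g^jk Ric_jk`. -/
def scalar (G : EuclideanSpace ℝ (Fin n) → Matrix (Fin n) (Fin n) ℝ)
    (y : EuclideanSpace ℝ (Fin n)) : ℝ :=
  ∑ j, ∑ k, (G y)⁻¹ j k * ricci G j k y

/-- The Hessian `(D dF)_ij = ∂_i ∂_j F - ∑_k Γ^k_ij ∂_k F`. -/
def hessian (G : EuclideanSpace ℝ (Fin n) → Matrix (Fin n) (Fin n) ℝ)
    (F : EuclideanSpace ℝ (Fin n) → ℝ) (i j : Fin n) (y : EuclideanSpace ℝ (Fin n)) : ℝ :=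
  pd i (pd j F) y - ∑ k, christoffel G k i j y * pd k F y

end RiemCoord

section Manifold

variable {n : ℕ} {M : Type*} [TopologicalSpace M] [ChartedSpace (EuclideanSpace ℝ (Fin n)) M]
  [IsManifold (𝓡 n) ∞ M]

/-- The matrix `g_ij = g(∂_i, ∂_j)` of the metric `g` in the chart `e`, as a function of the
coordinates. The coordinate field `∂_i` is the image of the `i`-th basis vector under the
differential of the inverse chart. Only points of `e.target` are meaningful. -/
def metricInChart
    (g : Bundle.ContMDiffRiemannianMetric (𝓡 n) ∞ (EuclideanSpace ℝ (Fin n))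
      (fun x : M => TangentSpace (𝓡 n) x))
    (e : OpenPartialHomeomorph M (EuclideanSpace ℝ (Fin n)))
    (y : EuclideanSpace ℝ (Fin n)) : Matrix (Fin n) (Fin n) ℝ :=
  Matrix.of fun i j =>
    g.inner (e.symm y)
      (mfderiv (𝓡 n) (𝓡 n) e.symm y
        (EuclideanSpace.single i (1 : ℝ) : EuclideanSpace ℝ (Fin n)))
      (mfderiv (𝓡 n) (𝓡 n) e.symm y
        (EuclideanSpace.single j (1 : ℝ) : EuclideanSpace ℝ (Fin n)))

/-- The scalar curvature of `g` is the constant `s` (computed in any smooth chart). -/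
def HasConstantScalarCurvature
    (g : Bundle.ContMDiffRiemannianMetric (𝓡 n) ∞ (EuclideanSpace ℝ (Fin n))
      (fun x : M => TangentSpace (𝓡 n) x)) (s : ℝ) : Prop :=
  ∀ e ∈ IsManifold.maximalAtlas (𝓡 n) ∞ M, ∀ y ∈ e.target,
    RiemCoord.scalar (metricInChart g e) y = s

/-- `(M, g, f)` is a generalized `(lam, n + m)`-Einstein manifold: `f` and `lam` are smooth
functions, `m` is a positive real number, and the tensor equation
`D df = (f / m) (Ric - lam g)` holds, written in components in every smooth chart. -/
structure IsGeneralizedEinstein (m : ℝ)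
    (g : Bundle.ContMDiffRiemannianMetric (𝓡 n) ∞ (EuclideanSpace ℝ (Fin n))
      (fun x : M => TangentSpace (𝓡 n) x)) (f lam : M → ℝ) : Prop where
  m_pos : 0 < m
  smooth_f : ContMDiff (𝓡 n) 𝓘(ℝ, ℝ) ∞ f
  smooth_lam : ContMDiff (𝓡 n) 𝓘(ℝ, ℝ) ∞ lam
  equation : ∀ e ∈ IsManifold.maximalAtlas (𝓡 n) ∞ M, ∀ y ∈ e.target, ∀ i j : Fin n,
    RiemCoord.hessian (metricInChart g e) (fun z => f (e.symm z)) i j y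
      = f (e.symm y) / m * (RiemCoord.ricci (metricInChart g e) i j y
          - lam (e.symm y) * metricInChart g e y i j)

end Manifold

end

/-! The proof applies the maximum principle twice on the set where `f > 0`. That set may be assumed
nonempty, since the equation is linear in `f` and `-f` satisfies it too.

Contracting the Ricci identity gives div(D df) - d(Δf) = Ric(∇f). Since s is constant, div Ric = 0
by the contracted Bianchi identity, and inserting the Einstein equation yields (m - 1) Ric(∇f) = dW
with W = ((n - 1)λ - s) f (`ricci_grad`). The divergence of this is ΔW = (m - 1)(f/m)(|Ric|² - λs),
while the trace of the equation is Δf = (f/m)(s - nλ). For w = -nW + (m - 1)s f = ((n + m - 1)s -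
n(n - 1)λ) f the terms in λ cancel: Δw = (m - 1)(f/m)(s² - n|Ric|²), which is at most 0 where `f >
0`, by Cauchy-Schwarz (`superharmonic`). As w vanishes with `f`, the maximum principle
(`nonpos_of_subharmonic`) gives w ≥ 0 where `f > 0`, that is n(n - 1)λ ≤ (n + m - 1)s there. If s ≤
0, then (n - 1)(s - nλ) ≥ -ms ≥ 0, so `f` is subharmonic where it is positive and zero on the
boundary of that set; hence `f` is nowhere positive, a contradiction.

The tensor identities are checked at the centre of a chart with g = 1 and ∂g = 0 there
(`exists_normal_chart`). The strong maximum principle is proved in coordinates with Hopf's barrier.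
-/

namespace RiemCoord

open Filter Topology

variable {n : ℕ} {F H : EuclideanSpace ℝ (Fin n) → ℝ} {y : EuclideanSpace ℝ (Fin n)}

/-! ### Calculus of partial derivatives -/

theorem pd_add (i : Fin n) (hF : ContDiffAt ℝ ∞ F y) (hH : ContDiffAt ℝ ∞ H y) :
    pd i (fun z => F z + H z) y = pd i F y + pd i H y := by
  simp only [pd]
  rw [fderiv_fun_add (hF.differentiableAt (by simp)) (hH.differentiableAt (by simp))]
  rfl

theorem pd_sub (i : Fin n) (hF : ContDiffAt ℝ ∞ F y) (hH : ContDiffAt ℝ ∞ H y) :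
    pd i (fun z => F z - H z) y = pd i F y - pd i H y := by
  simp only [pd]
  rw [fderiv_fun_sub (hF.differentiableAt (by simp)) (hH.differentiableAt (by simp))]
  rfl

theorem pd_neg (i : Fin n) : pd i (fun z => -F z) y = -pd i F y := by
  simp only [pd]
  rw [fderiv_fun_neg]
  rfl

theorem pd_mul (i : Fin n) (hF : ContDiffAt ℝ ∞ F y) (hH : ContDiffAt ℝ ∞ H y) :
    pd i (fun z => F z * H z) y = pd i F y * H y + F y * pd i H y := by
  simp only [pd]
  rw [fderiv_fun_mul (hF.differentiableAt (by simp)) (hH.differentiableAt (by simp))]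
  simp only [add_apply, smul_apply, smul_eq_mul]
  ring

theorem pd_const (i : Fin n) (c : ℝ) : pd i (fun _ => c) y = 0 := by
  simp [pd]

theorem pd_const_mul (i : Fin n) (c : ℝ) (hF : ContDiffAt ℝ ∞ F y) :
    pd i (fun z => c * F z) y = c * pd i F y := by
  rw [pd_mul i contDiffAt_const hF, pd_const]
  ring

theorem pd_sum {ι : Type*} (i : Fin n) (t : Finset ι) {A : ι → EuclideanSpace ℝ (Fin n) → ℝ}
    (hA : ∀ a, ContDiffAt ℝ ∞ (A a) y) :
    pd i (fun z => ∑ a ∈ t, A a z) y = ∑ a ∈ t, pd i (A a) y := by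
  simp only [pd]
  rw [fderiv_fun_sum fun a _ => (hA a).differentiableAt (by simp)]
  simp

theorem pd_congr (i : Fin n) (h : F =ᶠ[𝓝 y] H) : pd i F y = pd i H y := by
  simp only [pd, h.fderiv_eq]

theorem contDiffAt_pd (i : Fin n) (hF : ContDiffAt ℝ ∞ F y) : ContDiffAt ℝ ∞ (pd i F) y := by
  have h := hF.fderiv_right (m := ∞) (by simp)
  exact h.clm_apply contDiffAt_const

theorem pd_comm (i j : Fin n) (hF : ContDiffAt ℝ ∞ F y) :
    pd i (pd j F) y = pd j (pd i F) y := by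
  have h := (hF.fderiv_right (m := ∞) (by simp)).differentiableAt (by simp)
  have hs : IsSymmSndFDerivAt ℝ F y := hF.isSymmSndFDerivAt (by
    simpa using (mod_cast le_top : ((2 : ℕ∞) : WithTop ℕ∞) ≤ ∞))
  have key : ∀ a b : Fin n, pd a (pd b F) y
      = fderiv ℝ (fderiv ℝ F) y (EuclideanSpace.single a 1) (EuclideanSpace.single b 1) := by
    intro a b
    simp only [pd]
    change fderiv ℝ (fun z => fderiv ℝ F z (EuclideanSpace.single b 1)) y _ = _
    rw [fderiv_clm_apply h (differentiableAt_const _)]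
    simp
  rw [key, key, hs.eq]

theorem fderiv_eq_sum_pd (v : EuclideanSpace ℝ (Fin n)) :
    fderiv ℝ F y v = ∑ k, v k * pd k F y := by
  have hv : v = ∑ k, v k • EuclideanSpace.single k (1 : ℝ) := by
    have := (EuclideanSpace.basisFun (Fin n) ℝ).sum_repr v
    simpa using this.symm
  conv_lhs => rw [hv]
  simp [pd]

/-- The chain rule in coordinates. -/
theorem pd_comp (i : Fin n) {Ψ : EuclideanSpace ℝ (Fin n) → EuclideanSpace ℝ (Fin n)}
    (hF : ContDiffAt ℝ ∞ F (Ψ y)) (hΨ : ContDiffAt ℝ ∞ Ψ y) :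
    pd i (fun z => F (Ψ z)) y = ∑ k, pd k F (Ψ y) * pd i (fun z => Ψ z k) y := by
  have h1 := hF.differentiableAt (by simp)
  have h2 := hΨ.differentiableAt (by simp)
  have h3 : ∀ k, pd i (fun z => Ψ z k) y = (fderiv ℝ Ψ y (EuclideanSpace.single i 1)) k := by
    intro k
    have := ((EuclideanSpace.proj (𝕜 := ℝ) k).hasFDerivAt.comp y h2.hasFDerivAt).fderiv
    simp only [pd]
    change fderiv ℝ ((EuclideanSpace.proj (𝕜 := ℝ) k) ∘ Ψ) y _ = _
    rw [this]
    rfl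
  simp only [h3]
  have := (h1.hasFDerivAt.comp y h2.hasFDerivAt).fderiv
  change fderiv ℝ (F ∘ Ψ) y _ = _
  rw [this, ContinuousLinearMap.comp_apply, fderiv_eq_sum_pd]
  exact Finset.sum_congr rfl fun k _ => mul_comm _ _

/-- `F` is smooth at every point close to `y`. -/
def SmoothNear (F : EuclideanSpace ℝ (Fin n) → ℝ) (y : EuclideanSpace ℝ (Fin n)) : Prop :=
  ∀ᶠ z in 𝓝 y, ContDiffAt ℝ ∞ F z

namespace SmoothNear

theorem contDiffAt (hF : SmoothNear F y) : ContDiffAt ℝ ∞ F y :=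
  Filter.Eventually.self_of_nhds hF

theorem eventually (hF : SmoothNear F y) : ∀ᶠ z in 𝓝 y, SmoothNear F z :=
  eventually_eventually_nhds.2 hF

theorem const (c : ℝ) : SmoothNear (fun _ => c) y :=
  Eventually.of_forall fun _ => contDiffAt_const

theorem add (hF : SmoothNear F y) (hH : SmoothNear H y) : SmoothNear (fun z => F z + H z) y := by
  filter_upwards [hF, hH] with z h1 h2 using h1.add h2

theorem sub (hF : SmoothNear F y) (hH : SmoothNear H y) : SmoothNear (fun z => F z - H z) y := by
  filter_upwards [hF, hH] with z h1 h2 using h1.sub h2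

theorem mul (hF : SmoothNear F y) (hH : SmoothNear H y) : SmoothNear (fun z => F z * H z) y := by
  filter_upwards [hF, hH] with z h1 h2 using h1.mul h2

theorem sum {ι : Type*} [Finite ι] {t : Finset ι} {A : ι → EuclideanSpace ℝ (Fin n) → ℝ}
    (hA : ∀ a, SmoothNear (A a) y) : SmoothNear (fun z => ∑ a ∈ t, A a z) y := by
  filter_upwards [eventually_all.2 hA] with z h using ContDiffAt.sum fun a _ => h a

theorem prod {ι : Type*} [Finite ι] {t : Finset ι} {A : ι → EuclideanSpace ℝ (Fin n) → ℝ}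
    (hA : ∀ a, SmoothNear (A a) y) : SmoothNear (fun z => ∏ a ∈ t, A a z) y := by
  filter_upwards [eventually_all.2 hA] with z h using contDiffAt_prod fun a _ => h a

theorem pd (hF : SmoothNear F y) (i : Fin n) : SmoothNear (pd i F) y := by
  filter_upwards [hF] with z h using contDiffAt_pd i h

theorem inv (hF : SmoothNear F y) (h : F y ≠ 0) : SmoothNear (fun z => (F z)⁻¹) y := by
  filter_upwards [hF, hF.contDiffAt.continuousAt.eventually_ne h] with z h1 h2 using h1.inv h2

theorem congr (hF : SmoothNear F y) (h : F =ᶠ[𝓝 y] H) : SmoothNear H y := by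
  filter_upwards [hF, h.eventuallyEq_nhds] with z h1 h2 using h1.congr_of_eventuallyEq h2.symm

end SmoothNear

/-- The product rule for a second partial derivative. -/
theorem pd_pd_mul (i j : Fin n) (hF : SmoothNear F y) (hH : SmoothNear H y) :
    RiemCoord.pd i (RiemCoord.pd j fun z => F z * H z) y
      = pd i (pd j F) y * H y + pd j F y * pd i H y + pd i F y * pd j H y
        + F y * pd i (pd j H) y := by
  have h : pd j (fun z => F z * H z) =ᶠ[𝓝 y] fun z => pd j F z * H z + F z * pd j H z := by
    filter_upwards [hF, hH] with z h1 h2 using pd_mul j h1 h2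
  rw [pd_congr i h, pd_add i ((hF.pd j).mul hH).contDiffAt (hF.mul (hH.pd j)).contDiffAt,
    pd_mul i (hF.pd j).contDiffAt hH.contDiffAt, pd_mul i hF.contDiffAt (hH.pd j).contDiffAt]
  ring

theorem pd_pd_sum {ι : Type*} [Finite ι] (i j : Fin n) (t : Finset ι)
    {A : ι → EuclideanSpace ℝ (Fin n) → ℝ} (hA : ∀ a, SmoothNear (A a) y) :
    pd i (pd j fun z => ∑ a ∈ t, A a z) y = ∑ a ∈ t, pd i (pd j (A a)) y := by
  have h : pd j (fun z => ∑ a ∈ t, A a z) =ᶠ[𝓝 y] fun z => ∑ a ∈ t, pd j (A a) z := by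
    filter_upwards [eventually_all.2 hA] with z h1 using pd_sum j t h1
  rw [pd_congr i h, pd_sum i t fun a => ((hA a).pd j).contDiffAt]

/-! ### Smoothness of the geometric quantities -/

variable {G : EuclideanSpace ℝ (Fin n) → Matrix (Fin n) (Fin n) ℝ}

theorem SmoothNear.det {A : EuclideanSpace ℝ (Fin n) → Matrix (Fin n) (Fin n) ℝ}
    (hA : ∀ i j, SmoothNear (fun z => A z i j) y) : SmoothNear (fun z => (A z).det) y := by
  simp only [Matrix.det_apply']
  exact .sum fun σ => .mul (.const _) (.prod fun i => hA _ _)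

/-- By Cramer's rule an entry of the inverse is a cofactor divided by the determinant. -/
theorem SmoothNear.matrix_inv (hG : ∀ i j, SmoothNear (fun z => G z i j) y)
    (h : IsUnit (G y).det) (i j : Fin n) : SmoothNear (fun z => (G z)⁻¹ i j) y := by
  have h1 : (fun z => (G z)⁻¹ i j)
      = fun z => ((G z).det)⁻¹ * ((G z).updateRow j (Pi.single i 1)).det := by
    ext z
    rw [Matrix.inv_def, Ring.inverse_eq_inv', Matrix.smul_apply, Matrix.adjugate_apply, smul_eq_mul]
  rw [h1]
  refine .mul (.inv (.det hG) h.ne_zero) (.det fun a b => ?_)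
  by_cases hab : a = j
  · subst hab
    simpa using SmoothNear.const _
  · simpa [Matrix.updateRow_ne hab] using hG a b

theorem SmoothNear.christoffel (hG : ∀ i j, SmoothNear (fun z => G z i j) y)
    (h : IsUnit (G y).det) (k i j : Fin n) : SmoothNear (christoffel G k i j) y :=
  .mul (.const _) (.sum fun l => .mul (.matrix_inv hG h k l)
    (.sub (.add ((hG j l).pd i) ((hG i l).pd j)) ((hG i j).pd l)))

theorem SmoothNear.riemann (hG : ∀ i j, SmoothNear (fun z => G z i j) y)
    (h : IsUnit (G y).det) (l k i j : Fin n) : SmoothNear (riemann G l k i j) y :=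
  have hc := SmoothNear.christoffel hG h
  .add (.sub ((hc _ _ _).pd i) ((hc _ _ _).pd j))
    (.sum fun _ => .sub (.mul (hc _ _ _) (hc _ _ _)) (.mul (hc _ _ _) (hc _ _ _)))

theorem SmoothNear.ricci (hG : ∀ i j, SmoothNear (fun z => G z i j) y)
    (h : IsUnit (G y).det) (j k : Fin n) : SmoothNear (ricci G j k) y :=
  .sum fun _ => .riemann hG h _ _ _ _

theorem SmoothNear.hessian (hG : ∀ i j, SmoothNear (fun z => G z i j) y)
    (h : IsUnit (G y).det) (hF : SmoothNear F y) (i j : Fin n) : SmoothNear (hessian G F i j) y :=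
  .sub ((hF.pd j).pd i) (.sum fun k => .mul (.christoffel hG h k i j) (hF.pd k))

end RiemCoord

namespace RiemCoord

open Filter Topology

variable {n : ℕ} {F L : EuclideanSpace ℝ (Fin n) → ℝ} {y : EuclideanSpace ℝ (Fin n)}
  {G : EuclideanSpace ℝ (Fin n) → Matrix (Fin n) (Fin n) ℝ}

/-! ### Computations at a point where the coordinates are normal to first order -/

/-- The metric `G` is smooth near `y`, and `G y = 1`, `∂G y = 0`. -/
structure IsNormalAt (G : EuclideanSpace ℝ (Fin n) → Matrix (Fin n) (Fin n) ℝ)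
    (y : EuclideanSpace ℝ (Fin n)) : Prop where
  smooth : ∀ i j, SmoothNear (fun z => G z i j) y
  symm : ∀ z i j, G z i j = G z j i
  eq_one : G y = 1
  pd_eq_zero : ∀ k i j, pd k (fun z => G z i j) y = 0

/-- The Christoffel symbols of the first kind (twice). -/
noncomputable def christoffelLower (G : EuclideanSpace ℝ (Fin n) → Matrix (Fin n) (Fin n) ℝ) (l i j : Fin n)
    (y : EuclideanSpace ℝ (Fin n)) : ℝ :=
  pd i (fun z => G z j l) y + pd j (fun z => G z i l) y - pd l (fun z => G z i j) y

theorem SmoothNear.christoffelLower (hG : ∀ i j, SmoothNear (fun z => G z i j) y)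
    (l i j : Fin n) : SmoothNear (christoffelLower G l i j) y :=
  .sub (.add ((hG j l).pd i) ((hG i l).pd j)) ((hG i j).pd l)

namespace IsNormalAt

theorem isUnit (hN : IsNormalAt G y) : IsUnit (G y).det := by
  simp [hN.eq_one]

theorem eventually_isUnit (hN : IsNormalAt G y) : ∀ᶠ z in 𝓝 y, IsUnit (G z).det := by
  filter_upwards [(SmoothNear.det hN.smooth).contDiffAt.continuousAt.eventually_ne
    hN.isUnit.ne_zero] with z hz using isUnit_iff_ne_zero.2 hz

theorem smooth_inv (hN : IsNormalAt G y) (i j : Fin n) : SmoothNear (fun z => (G z)⁻¹ i j) y :=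
  .matrix_inv hN.smooth hN.isUnit i j

theorem smooth_christoffel (hN : IsNormalAt G y) (k i j : Fin n) :
    SmoothNear (christoffel G k i j) y :=
  .christoffel hN.smooth hN.isUnit k i j

/-- Differentiate `G⁻¹ * G = 1` and use that `∂G` vanishes at the point. -/
theorem pd_inv (hN : IsNormalAt G y) (k i j : Fin n) : pd k (fun z => (G z)⁻¹ i j) y = 0 := by
  have h1 : (fun z => ∑ l, (G z)⁻¹ i l * G z l j) =ᶠ[𝓝 y] fun _ => (1 : Matrix _ _ ℝ) i j := by
    filter_upwards [hN.eventually_isUnit] with z hz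
    rw [← Matrix.nonsing_inv_mul _ hz, Matrix.mul_apply]
  have h2 := pd_congr k h1
  rw [pd_const, pd_sum k _ fun l => ((hN.smooth_inv i l).mul (hN.smooth l j)).contDiffAt] at h2
  simp_rw [pd_mul k (hN.smooth_inv i _).contDiffAt (hN.smooth _ j).contDiffAt,
    hN.pd_eq_zero, hN.eq_one] at h2
  simpa [Matrix.one_apply] using h2

theorem christoffelLower_eq_zero (hN : IsNormalAt G y) (l i j : Fin n) :
    christoffelLower G l i j y = 0 := by
  simp [christoffelLower, hN.pd_eq_zero]

theorem christoffel_eq_zero (hN : IsNormalAt G y) (k i j : Fin n) :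
    christoffel G k i j y = 0 := by
  simp [christoffel, hN.pd_eq_zero]

/-- The lowered symbols vanish at the point, so differentiating the inverse metric contributes
nothing. -/
theorem pd_christoffel (hN : IsNormalAt G y) (a k i j : Fin n) :
    pd a (christoffel G k i j) y = 1 / 2 * (pd a (pd i fun z => G z j k) y
      + pd a (pd j fun z => G z i k) y - pd a (pd k fun z => G z i j) y) := by
  have hs := fun l => SmoothNear.christoffelLower hN.smooth l i j
  have h1 : pd a (christoffel G k i j) y = 1 / 2 * pd a (christoffelLower G k i j) y := by
    change pd a (fun z => (1 / 2 : ℝ) * ∑ l, (G z)⁻¹ k l * christoffelLower G l i j z) y = _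
    rw [pd_const_mul a _ (SmoothNear.sum fun l => (hN.smooth_inv k l).mul (hs l)).contDiffAt,
      pd_sum a _ fun l => ((hN.smooth_inv k l).mul (hs l)).contDiffAt]
    simp_rw [pd_mul a (hN.smooth_inv k _).contDiffAt (hs _).contDiffAt,
      hN.christoffelLower_eq_zero, hN.eq_one]
    simp [Matrix.one_apply]
  rw [h1]
  congr 1
  change pd a (fun z => pd i (fun z => G z j k) z + pd j (fun z => G z i k) z
    - pd k (fun z => G z i j) z) y = _
  rw [pd_sub a (((hN.smooth j k).pd i).add ((hN.smooth i k).pd j)).contDiffAt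
    ((hN.smooth i j).pd k).contDiffAt, pd_add a ((hN.smooth j k).pd i).contDiffAt
    ((hN.smooth i k).pd j).contDiffAt]

/-- Terms with one derivative on `G⁻¹` die by `pd_inv`; the term with two derivatives on it
multiplies a lowered symbol, which is zero. -/
theorem pd_pd_christoffel (hN : IsNormalAt G y) (b a k i j : Fin n) :
    pd b (pd a (christoffel G k i j)) y = 1 / 2 * (pd b (pd a (pd i fun z => G z j k)) y
      + pd b (pd a (pd j fun z => G z i k)) y - pd b (pd a (pd k fun z => G z i j)) y) := by
  have hs := fun l => SmoothNear.christoffelLower hN.smooth l i j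
  have h1 : pd b (pd a (christoffel G k i j)) y
      = 1 / 2 * pd b (pd a (christoffelLower G k i j)) y := by
    change pd b (pd a (fun z => (1 / 2 : ℝ) * ∑ l, (G z)⁻¹ k l * christoffelLower G l i j z)) y = _
    rw [pd_pd_mul b a (.const _) (SmoothNear.sum fun l => (hN.smooth_inv k l).mul (hs l)),
      pd_pd_sum b a _ fun l => ((hN.smooth_inv k l).mul (hs l))]
    simp_rw [pd_pd_mul b a (hN.smooth_inv k _) (hs _),
      hN.christoffelLower_eq_zero, hN.pd_inv, hN.eq_one]
    have h0 : ∀ c, pd c (fun _ : EuclideanSpace ℝ (Fin n) => (1 / 2 : ℝ)) = fun _ => 0 := by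
      intro c; ext z; exact pd_const c _
    simp only [h0, pd_const]
    simp [Matrix.one_apply]
  rw [h1]
  congr 1
  have h2 : pd a (christoffelLower G k i j) =ᶠ[𝓝 y] fun z => pd a (pd i (fun z => G z j k)) z
      + pd a (pd j (fun z => G z i k)) z - pd a (pd k (fun z => G z i j)) z := by
    filter_upwards [hN.smooth i j, hN.smooth j k, hN.smooth i k] with z h1 h2 h3
    change pd a (fun z => pd i (fun z => G z j k) z + pd j (fun z => G z i k) z
      - pd k (fun z => G z i j) z) z = _
    have h1 := contDiffAt_pd k h1
    have h2 := contDiffAt_pd i h2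
    have h3 := contDiffAt_pd j h3
    rw [pd_sub a (h2.add h3) h1, pd_add a h2 h3]
  rw [pd_congr b h2, pd_sub b ((((hN.smooth j k).pd i).pd a).add
    (((hN.smooth i k).pd j).pd a)).contDiffAt
    (((hN.smooth i j).pd k).pd a).contDiffAt, pd_add b (((hN.smooth j k).pd i).pd a).contDiffAt
    (((hN.smooth i k).pd j).pd a).contDiffAt]

theorem symm' (hN : IsNormalAt G y) (i j : Fin n) : (fun z => G z i j) = fun z => G z j i :=
  funext fun z => hN.symm z i j

theorem riemann_eq (hN : IsNormalAt G y) (l k i j : Fin n) :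
    riemann G l k i j y = pd i (christoffel G l j k) y - pd j (christoffel G l i k) y := by
  simp [riemann, hN.christoffel_eq_zero]

/-- The quadratic part drops out: each term of its derivative keeps an undifferentiated Christoffel
symbol. -/
theorem pd_riemann (hN : IsNormalAt G y) (a l k i j : Fin n) :
    pd a (riemann G l k i j) y
      = pd a (pd i (christoffel G l j k)) y - pd a (pd j (christoffel G l i k)) y := by
  have hc := hN.smooth_christoffel
  have hq := fun p => ((hc l i p).mul (hc p j k)).sub ((hc l j p).mul (hc p i k))
  change pd a (fun z => pd i (christoffel G l j k) z - pd j (christoffel G l i k) z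
    + ∑ p, (christoffel G l i p z * christoffel G p j k z
      - christoffel G l j p z * christoffel G p i k z)) y = _
  rw [pd_add a (((hc l j k).pd i).sub ((hc l i k).pd j)).contDiffAt
    (SmoothNear.sum hq).contDiffAt, pd_sub a ((hc l j k).pd i).contDiffAt
    ((hc l i k).pd j).contDiffAt, pd_sum a _ fun p => (hq p).contDiffAt]
  simp_rw [pd_sub a ((hc l i _).mul (hc _ j k)).contDiffAt ((hc l j _).mul (hc _ i k)).contDiffAt,
    pd_mul a (hc _ _ _).contDiffAt (hc _ _ _).contDiffAt, hN.christoffel_eq_zero]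
  simp

theorem ricci_eq (hN : IsNormalAt G y) (j k : Fin n) :
    ricci G j k y = ∑ i, 1 / 2 * (pd i (pd j fun z => G z i k) y + pd i (pd k fun z => G z i j) y
      - pd i (pd i fun z => G z j k) y - pd j (pd k fun z => G z i i) y) := by
  refine Finset.sum_congr rfl fun i _ => ?_
  rw [hN.riemann_eq, hN.pd_christoffel, hN.pd_christoffel, hN.symm' k i, hN.symm' j i,
    pd_comm j i (hN.smooth i k).contDiffAt]
  ring

theorem ricci_symm (hN : IsNormalAt G y) (j k : Fin n) : ricci G j k y = ricci G k j y := by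
  rw [hN.ricci_eq, hN.ricci_eq]
  refine Finset.sum_congr rfl fun i _ => ?_
  rw [hN.symm' k j, pd_comm j k (hN.smooth i i).contDiffAt]
  ring

theorem pd_ricci (hN : IsNormalAt G y) (a j k : Fin n) :
    pd a (ricci G j k) y = ∑ i, 1 / 2 * (pd a (pd i (pd j fun z => G z i k)) y
      + pd a (pd i (pd k fun z => G z i j)) y
      - pd a (pd i (pd i fun z => G z j k)) y - pd a (pd j (pd k fun z => G z i i)) y) := by
  change pd a (fun z => ∑ i, riemann G i k i j z) y = _
  rw [pd_sum a _ fun i => (SmoothNear.riemann hN.smooth hN.isUnit i k i j).contDiffAt]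
  refine Finset.sum_congr rfl fun i _ => ?_
  have h : pd j (pd i fun z => G z i k) =ᶠ[𝓝 y] pd i (pd j fun z => G z i k) := by
    filter_upwards [hN.smooth i k] with z hz using pd_comm j i hz
  rw [hN.pd_riemann, hN.pd_pd_christoffel, hN.pd_pd_christoffel, hN.symm' k i, hN.symm' j i,
    pd_congr a h]
  ring

theorem smooth_ricci (hN : IsNormalAt G y) (j k : Fin n) : SmoothNear (ricci G j k) y :=
  .ricci hN.smooth hN.isUnit j k

theorem scalar_eq (hN : IsNormalAt G y) : scalar G y = ∑ j, ricci G j j y := by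
  simp [scalar, hN.eq_one, Matrix.one_apply]

theorem pd_scalar (hN : IsNormalAt G y) (a : Fin n) :
    pd a (scalar G) y = ∑ j, pd a (ricci G j j) y := by
  have hs := fun j k => (hN.smooth_inv j k).mul (hN.smooth_ricci j k)
  change pd a (fun z => ∑ j, ∑ k, (G z)⁻¹ j k * ricci G j k z) y = _
  rw [pd_sum a _ fun j => (SmoothNear.sum fun k => hs j k).contDiffAt]
  simp_rw [pd_sum a _ fun k => (hs _ k).contDiffAt,
    pd_mul a (hN.smooth_inv _ _).contDiffAt (hN.smooth_ricci _ _).contDiffAt, hN.pd_inv, hN.eq_one]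
  simp [Matrix.one_apply]

/-- The contracted second Bianchi identity. -/
theorem sum_pd_ricci (hN : IsNormalAt G y) (k : Fin n) :
    ∑ j, pd j (ricci G j k) y = 1 / 2 * pd k (scalar G) y := by
  -- With the quadratic terms gone, the identity is linear in the third derivatives of the metric
  -- and follows by permuting derivatives and renaming summation indices.
  have hc : ∀ a b c i j, pd a (pd b (pd c fun z => G z i j)) y
      = pd b (pd a (pd c fun z => G z i j)) y :=
    fun a b c i j => pd_comm a b ((hN.smooth i j).pd c).contDiffAt
  have hc' : ∀ a b c i j, pd a (pd b (pd c fun z => G z i j)) y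
      = pd a (pd c (pd b fun z => G z i j)) y := by
    intro a b c i j
    refine pd_congr a ?_
    filter_upwards [hN.smooth i j] with z hz using pd_comm b c hz
  rw [hN.pd_scalar]
  simp_rw [hN.pd_ricci]
  have e1 : ∑ j, ∑ i, pd j (pd i (pd i fun z => G z j k)) y
      = ∑ j, ∑ i, pd j (pd i (pd j fun z => G z i k)) y := by
    rw [Finset.sum_comm]
    refine Finset.sum_congr rfl fun i _ => Finset.sum_congr rfl fun j _ => ?_
    rw [hc]
  have e2 : ∑ j, ∑ i, pd k (pd i (pd i fun z => G z j j)) y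
      = ∑ j, ∑ i, pd j (pd j (pd k fun z => G z i i)) y := by
    rw [Finset.sum_comm]
    refine Finset.sum_congr rfl fun i _ => Finset.sum_congr rfl fun j _ => ?_
    rw [hc k, hc' i k]
  have e3 : ∑ j, ∑ i, pd k (pd j (pd j fun z => G z i i)) y
      = ∑ j, ∑ i, pd j (pd j (pd k fun z => G z i i)) y := by
    refine Finset.sum_congr rfl fun i _ => Finset.sum_congr rfl fun j _ => ?_
    rw [hc k, hc' i k]
  have e4 : ∑ j, ∑ i, pd k (pd i (pd j fun z => G z i j)) y
      = ∑ j, ∑ i, pd j (pd i (pd k fun z => G z i j)) y := by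
    refine Finset.sum_congr rfl fun i _ => Finset.sum_congr rfl fun j _ => ?_
    rw [hc k, hc' j, hc j]
  simp only [mul_add, mul_sub, Finset.sum_add_distrib, Finset.sum_sub_distrib, ← Finset.mul_sum,
    e1, e2, e3, e4]
  ring

end IsNormalAt

end RiemCoord

/-! ### The generalized Einstein equation at a normal point -/

namespace RiemCoord

open Filter Topology

variable {n : ℕ} {F L : EuclideanSpace ℝ (Fin n) → ℝ} {y : EuclideanSpace ℝ (Fin n)}
  {G : EuclideanSpace ℝ (Fin n) → Matrix (Fin n) (Fin n) ℝ}

/-- The generalized Einstein equation holds near `y`, for smooth data, and the scalar curvature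
is equal to `s` near `y`. -/
structure EinsteinNear (G : EuclideanSpace ℝ (Fin n) → Matrix (Fin n) (Fin n) ℝ)
    (F L : EuclideanSpace ℝ (Fin n) → ℝ) (m s : ℝ) (y : EuclideanSpace ℝ (Fin n)) : Prop where
  smooth_F : SmoothNear F y
  smooth_L : SmoothNear L y
  equation : ∀ᶠ z in 𝓝 y, ∀ i j,
    hessian G F i j z = F z / m * (ricci G i j z - L z * G z i j)
  scalar_eq : scalar G =ᶠ[𝓝 y] fun _ => s

namespace IsNormalAt

theorem hessian_eq (hN : IsNormalAt G y) (i j : Fin n) :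
    hessian G F i j y = pd i (pd j F) y := by
  simp [hessian, hN.christoffel_eq_zero]

theorem pd_hessian (hN : IsNormalAt G y) (hF : SmoothNear F y) (k i j : Fin n) :
    pd k (hessian G F i j) y
      = pd k (pd i (pd j F)) y - ∑ a, pd k (christoffel G a i j) y * pd a F y := by
  have hc := fun a => (hN.smooth_christoffel a i j).mul (hF.pd a)
  change pd k (fun z => pd i (pd j F) z - ∑ a, christoffel G a i j z * pd a F z) y = _
  rw [pd_sub k ((hF.pd j).pd i).contDiffAt (SmoothNear.sum hc).contDiffAt,
    pd_sum k _ fun a => (hc a).contDiffAt]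
  simp_rw [pd_mul k (hN.smooth_christoffel _ i j).contDiffAt (hF.pd _).contDiffAt,
    hN.christoffel_eq_zero]
  simp

/-- The contracted Ricci identity `div (D dF) - d (ΔF) = Ric (∇F)`. -/
theorem sum_pd_hessian_sub (hN : IsNormalAt G y) (hF : SmoothNear F y) (j : Fin n) :
    ∑ i, pd i (hessian G F i j) y - ∑ i, pd j (hessian G F i i) y
      = ∑ a, ricci G j a y * pd a F y := by
  have h1 : ∀ i, pd i (hessian G F i j) y - pd j (hessian G F i i) y
      = ∑ a, 1 / 2 * (pd i (pd j fun z => G z i a) y + pd i (pd a fun z => G z i j) y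
      - pd i (pd i fun z => G z j a) y - pd j (pd a fun z => G z i i) y) * pd a F y := by
    intro i
    -- The third derivatives of `F` cancel; what is left is a difference of derivatives of
    -- Christoffel symbols, whose trace is the Ricci tensor.
    have hc : pd i (pd i (pd j F)) y = pd j (pd i (pd i F)) y := by
      rw [pd_comm j i (hF.pd i).contDiffAt]
      refine pd_congr i ?_
      filter_upwards [hF] with z hz using pd_comm i j hz
    rw [hN.pd_hessian hF, hN.pd_hessian hF, hc, sub_sub_sub_cancel_left, ← Finset.sum_sub_distrib]
    refine Finset.sum_congr rfl fun a _ => ?_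
    rw [hN.pd_christoffel, hN.pd_christoffel, pd_comm j i (hN.smooth i a).contDiffAt]
    ring
  rw [← Finset.sum_sub_distrib]
  simp_rw [h1, hN.ricci_eq, Finset.sum_mul]
  rw [Finset.sum_comm]

variable {m s : ℝ}

/-- The factor `m` on both sides lets this rewrite the Ricci identity multiplied by `m`, where `m *
m⁻¹` then cancels. -/
theorem pd_hessian_of_einstein (hN : IsNormalAt G y) (hE : EinsteinNear G F L m s y)
    (k i j : Fin n) : m * pd k (hessian G F i j) y
      = m * (m⁻¹ * (pd k F y * (ricci G i j y - L y * (1 : Matrix (Fin n) (Fin n) ℝ) i j)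
        + F y * (pd k (ricci G i j) y - pd k L y * (1 : Matrix (Fin n) (Fin n) ℝ) i j))) := by
  have h : hessian G F i j =ᶠ[𝓝 y]
      fun z => m⁻¹ * (F z * (ricci G i j z - L z * G z i j)) := by
    filter_upwards [hE.equation] with z hz
    rw [hz]
    ring
  have hG := hE.smooth_L.mul (hN.smooth i j)
  have hR := (hN.smooth_ricci i j).sub hG
  rw [pd_congr k h, pd_const_mul k _ (hE.smooth_F.mul hR).contDiffAt,
    pd_mul k hE.smooth_F.contDiffAt hR.contDiffAt,
    pd_sub k (hN.smooth_ricci i j).contDiffAt hG.contDiffAt,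
    pd_mul k hE.smooth_L.contDiffAt (hN.smooth i j).contDiffAt, hN.pd_eq_zero, hN.eq_one]
  ring

/-- The identity `(m - 1) Ric (∇F) = d (((n - 1) L - s) F)`. -/
theorem ricci_grad (hN : IsNormalAt G y) (hE : EinsteinNear G F L m s y) (hm : m ≠ 0)
    (j : Fin n) : (m - 1) * ∑ a, ricci G j a y * pd a F y
      = pd j (fun z => (((n : ℝ) - 1) * L z - s) * F z) y := by
  have hF := hE.smooth_F
  have hL := hE.smooth_L
  have hds : ∀ k, pd k (scalar G) y = 0 := fun k => by rw [pd_congr k hE.scalar_eq, pd_const]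
  have hsc : ∑ i, ricci G i i y = s := by
    rw [← hN.scalar_eq]; exact hE.scalar_eq.self_of_nhds
  have hdsc : ∑ i, pd j (ricci G i i) y = 0 := by rw [← hN.pd_scalar, hds]
  have hdiv : ∑ i, pd i (ricci G i j) y = 0 := by rw [hN.sum_pd_ricci, hds, mul_zero]
  have hW : pd j (fun z => (((n : ℝ) - 1) * L z - s) * F z) y
      = ((n : ℝ) - 1) * pd j L y * F y + (((n : ℝ) - 1) * L y - s) * pd j F y := by
    have h1 := (SmoothNear.const ((n : ℝ) - 1)).mul hL
    rw [pd_mul j (h1.sub (.const s)).contDiffAt hF.contDiffAt,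
      pd_sub j h1.contDiffAt contDiffAt_const, pd_const_mul j _ hL.contDiffAt, pd_const, sub_zero]
  have e1 : ∑ i, pd i F y * ricci G i j y = ∑ a, ricci G j a y * pd a F y :=
    Finset.sum_congr rfl fun i _ => by rw [hN.ricci_symm i j, mul_comm]
  -- Every Hessian in the Ricci identity is replaced through the equation; the divergence of Ricci
  -- and the derivative of the scalar curvature vanish, leaving one Ricci term on each side.
  have key := congrArg (m * ·) (hN.sum_pd_hessian_sub hF j)
  simp only [mul_sub, Finset.mul_sum, hN.pd_hessian_of_einstein hE,
    mul_inv_cancel_left₀ hm] at key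
  simp only [← Finset.mul_sum] at key
  simp only [Finset.sum_add_distrib, Finset.sum_sub_distrib, ← Finset.mul_sum,
    hsc, hdsc, hdiv, e1, Matrix.one_apply_eq, Finset.sum_const, Finset.card_univ, Fintype.card_fin,
    nsmul_eq_mul, mul_one, mul_zero, Matrix.one_apply, mul_ite, Finset.sum_ite_eq',
    Finset.mem_univ, if_true] at key
  rw [hW]
  linarith

/-- Take the divergence of (m - 1) Ric(∇F) = dW. As div Ric = 0, only the pairing of Ric with the
Hessian survives, and the equation evaluates it. The identity has to be differentiated, so `hV` asks
for it on a neighbourhood, where the coordinates need not be normal and the inverse metric must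
appear. -/
theorem laplacian_aux (hN : IsNormalAt G y) (hE : EinsteinNear G F L m s y)
    (hV : ∀ᶠ z in 𝓝 y, ∀ j, (m - 1) * ∑ a, ricci G j a z * ∑ b, (G z)⁻¹ a b * pd b F z
      = pd j (fun z => (((n : ℝ) - 1) * L z - s) * F z) z) :
    ∑ j, pd j (pd j (fun z => (((n : ℝ) - 1) * L z - s) * F z)) y
      = (m - 1) * (F y / m) * (∑ j, ∑ a, ricci G j a y ^ 2 - L y * s) := by
  have hF := hE.smooth_F
  have hds : ∀ k, pd k (scalar G) y = 0 := fun k => by rw [pd_congr k hE.scalar_eq, pd_const]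
  have hsc : ∑ i, ricci G i i y = s := by
    rw [← hN.scalar_eq]; exact hE.scalar_eq.self_of_nhds
  have hg := fun a b => (hN.smooth_inv a b).mul (hF.pd b)
  have hr := fun j a => (hN.smooth_ricci j a).mul (SmoothNear.sum (t := .univ) (hg a))
  have hgrad : ∀ j a, pd j (fun z => ∑ b, (G z)⁻¹ a b * pd b F z) y = pd j (pd a F) y := by
    intro j a
    rw [pd_sum j _ fun b => (hg a b).contDiffAt]
    simp_rw [pd_mul j (hN.smooth_inv a _).contDiffAt (hF.pd _).contDiffAt, hN.pd_inv, hN.eq_one]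
    simp [Matrix.one_apply]
  have h1 : ∀ j, pd j (pd j (fun z => (((n : ℝ) - 1) * L z - s) * F z)) y
      = (m - 1) * ∑ a, (pd j (ricci G j a) y * pd a F y + ricci G j a y * pd j (pd a F) y) := by
    intro j
    have h2 : pd j (fun z => (((n : ℝ) - 1) * L z - s) * F z) =ᶠ[𝓝 y]
        fun z => (m - 1) * ∑ a, ricci G j a z * ∑ b, (G z)⁻¹ a b * pd b F z := by
      filter_upwards [hV] with z hz using (hz j).symm
    rw [pd_congr j h2, pd_const_mul j _ (SmoothNear.sum (hr j)).contDiffAt,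
      pd_sum j _ fun a => (hr j a).contDiffAt]
    simp_rw [pd_mul j (hN.smooth_ricci j _).contDiffAt (SmoothNear.sum (hg _)).contDiffAt, hgrad,
      hN.eq_one]
    simp [Matrix.one_apply]
  have h3 : ∑ j, ∑ a, pd j (ricci G j a) y * pd a F y = 0 := by
    rw [Finset.sum_comm]
    refine Finset.sum_eq_zero fun a _ => ?_
    rw [← Finset.sum_mul, hN.sum_pd_ricci, hds]
    simp
  have h4 : ∑ j, ∑ a, ricci G j a y * pd j (pd a F) y
      = F y / m * (∑ j, ∑ a, ricci G j a y ^ 2 - L y * s) := by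
    have h5 : ∀ j a, ricci G j a y * pd j (pd a F) y = F y / m * (ricci G j a y ^ 2
        - L y * (if j = a then ricci G j a y else 0)) := by
      intro j a
      rw [← hN.hessian_eq, hE.equation.self_of_nhds j a, hN.eq_one, Matrix.one_apply]
      split_ifs <;> ring
    simp_rw [h5, ← Finset.mul_sum, Finset.sum_sub_distrib, ← Finset.mul_sum]
    simp [hsc]
  simp_rw [h1, ← Finset.mul_sum, Finset.sum_add_distrib]
  rw [h3, h4]
  ring

theorem sum_pd_pd_of_einstein (hN : IsNormalAt G y) (hE : EinsteinNear G F L m s y) :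
    ∑ j, pd j (pd j F) y = F y / m * (s - n * L y) := by
  have hsc : ∑ i, ricci G i i y = s := by
    rw [← hN.scalar_eq]; exact hE.scalar_eq.self_of_nhds
  have h5 : ∀ j, pd j (pd j F) y = F y / m * (ricci G j j y - L y) := by
    intro j
    rw [← hN.hessian_eq, hE.equation.self_of_nhds j j, hN.eq_one, Matrix.one_apply_eq, mul_one]
  simp_rw [h5, ← Finset.mul_sum, Finset.sum_sub_distrib, hsc]
  simp

/-- The function `((n + m - 1) s - n (n - 1) L) F` is superharmonic where `F` is positive. -/
theorem superharmonic (hN : IsNormalAt G y) (hE : EinsteinNear G F L m s y) (hm : 1 < m)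
    (hpos : 0 < F y)
    (hV : ∀ᶠ z in 𝓝 y, ∀ j, (m - 1) * ∑ a, ricci G j a z * ∑ b, (G z)⁻¹ a b * pd b F z
      = pd j (fun z => (((n : ℝ) - 1) * L z - s) * F z) z) :
    ∑ j, pd j (pd j fun z => ((n + m - 1) * s - n * ((n : ℝ) - 1) * L z) * F z) y ≤ 0 := by
  have hF := hE.smooth_F
  have hL := hE.smooth_L
  have hsc : ∑ i, ricci G i i y = s := by
    rw [← hN.scalar_eq]; exact hE.scalar_eq.self_of_nhds
  have hW : SmoothNear (fun z => (((n : ℝ) - 1) * L z - s) * F z) y :=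
    ((((SmoothNear.const _).mul hL).sub (.const _)).mul hF)
  have h1 : ∀ j, pd j (pd j fun z => ((n + m - 1) * s - n * ((n : ℝ) - 1) * L z) * F z) y
      = (-n) * pd j (pd j fun z => (((n : ℝ) - 1) * L z - s) * F z) y
        + (m - 1) * s * pd j (pd j F) y := by
    intro j
    -- This combination is chosen so that the terms `L * s` in the two Laplacians cancel.
    have h2 : (fun z => ((n + m - 1) * s - n * ((n : ℝ) - 1) * L z) * F z)
        = fun z => (-n : ℝ) * ((((n : ℝ) - 1) * L z - s) * F z) + ((m - 1) * s) * F z := by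
      ext z; ring
    have h3 : pd j (fun z => (-n : ℝ) * ((((n : ℝ) - 1) * L z - s) * F z) + ((m - 1) * s) * F z)
        =ᶠ[𝓝 y] fun z => (-n : ℝ) * pd j (fun z => (((n : ℝ) - 1) * L z - s) * F z) z
          + ((m - 1) * s) * pd j F z := by
      filter_upwards [hW, hF] with z hz hz'
      rw [pd_add j (contDiffAt_const.mul hz) (contDiffAt_const.mul hz'), pd_const_mul j _ hz,
        pd_const_mul j _ hz']
    rw [h2, pd_congr j h3, pd_add j ((SmoothNear.const _).mul (hW.pd j)).contDiffAt
      ((SmoothNear.const _).mul (hF.pd j)).contDiffAt, pd_const_mul j _ (hW.pd j).contDiffAt,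
      pd_const_mul j _ (hF.pd j).contDiffAt]
  simp_rw [h1, Finset.sum_add_distrib, ← Finset.mul_sum]
  rw [hN.laplacian_aux hE hV, hN.sum_pd_pd_of_einstein hE]
  -- Cauchy-Schwarz for the diagonal of Ricci, whose sum is `s`; the off-diagonal squares only help.
  have h4 : s ^ 2 ≤ n * ∑ j, ∑ a, ricci G j a y ^ 2 := by
    have h5 := sq_sum_le_card_mul_sum_sq (s := Finset.univ) (f := fun i => ricci G i i y)
    rw [hsc, Finset.card_univ, Fintype.card_fin] at h5
    refine h5.trans ?_
    gcongr with j
    exact Finset.single_le_sum (f := fun a => ricci G j a y ^ 2) (fun a _ => sq_nonneg _)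
      (Finset.mem_univ j)
  have h6 : 0 ≤ (m - 1) * (F y / m) := by
    have : 0 < m := by linarith
    exact mul_nonneg (by linarith) (by positivity)
  nlinarith [mul_nonneg h6 (sub_nonneg.2 h4)]

end IsNormalAt

end RiemCoord

namespace RiemCoord

open Filter Topology

variable {n : ℕ} {v w : EuclideanSpace ℝ (Fin n) → ℝ} {y : EuclideanSpace ℝ (Fin n)}
  {G G' : EuclideanSpace ℝ (Fin n) → Matrix (Fin n) (Fin n) ℝ}
  {Ψ : EuclideanSpace ℝ (Fin n) → EuclideanSpace ℝ (Fin n)} {A : Matrix (Fin n) (Fin n) ℝ}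

/-! ### Normal coordinates to first order -/

/-- `Ψ` has the two-jet at `0` of a map that makes `G` normal at `y`. -/
structure IsNormalMap (G : EuclideanSpace ℝ (Fin n) → Matrix (Fin n) (Fin n) ℝ)
    (y : EuclideanSpace ℝ (Fin n)) (A : Matrix (Fin n) (Fin n) ℝ)
    (Ψ : EuclideanSpace ℝ (Fin n) → EuclideanSpace ℝ (Fin n)) : Prop where
  smooth : ContDiff ℝ ∞ Ψ
  map_zero : Ψ 0 = y
  congr_eq_one : A.transpose * G y * A = 1
  pd_eq : ∀ k i, pd i (fun z => Ψ z k) 0 = A k i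
  pd_pd_eq : ∀ k i j, pd j (pd i fun z => Ψ z k) 0
    = -∑ a, ∑ b, christoffel G k a b y * A a j * A b i

theorem christoffel_symm (hG : ∀ z i j, G z i j = G z j i) (k i j : Fin n)
    (y : EuclideanSpace ℝ (Fin n)) : christoffel G k i j y = christoffel G k j i y := by
  have h : (fun z => G z i j) = fun z => G z j i := funext fun z => hG z i j
  simp only [christoffel, h]
  congr 1
  exact Finset.sum_congr rfl fun l _ => by ring

/-- The first Christoffel symbols are recovered by lowering the index. -/
theorem sum_mul_christoffel (hG : ∀ z i j, G z i j = G z j i) (h : IsUnit (G y).det)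
    (b i j : Fin n) : ∑ a, G y a b * christoffel G a i j y = 1 / 2 * christoffelLower G b i j y := by
  simp_rw [hG y _ b]
  have h1 : ∀ a, christoffel G a i j y
      = 1 / 2 * ((G y)⁻¹.mulVec fun l => christoffelLower G l i j y) a := fun a => rfl
  have h2 : ∀ u : Fin n → ℝ, ∑ a, G y b a * u a = (G y).mulVec u b := fun u => rfl
  simp_rw [h1, mul_left_comm (G y b _), ← Finset.mul_sum, h2]
  rw [Matrix.mulVec_mulVec, Matrix.mul_nonsing_inv _ h, Matrix.one_mulVec]

/-- Diagonalize `S` as U D Uᵀ and take A = U D^(-1/2). -/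
theorem exists_congr_eq_one {S : Matrix (Fin n) (Fin n) ℝ} (hS : S.PosDef) :
    ∃ A : Matrix (Fin n) (Fin n) ℝ, A.transpose * S * A = 1 := by
  obtain ⟨U, e, hU, hpos, hsp⟩ : ∃ (U : Matrix (Fin n) (Fin n) ℝ) (e : Fin n → ℝ),
      U.transpose * U = 1 ∧ (∀ i, 0 < e i) ∧ S = U * Matrix.diagonal e * U.transpose := by
    have hH := hS.isHermitian
    have hsp := hH.spectral_theorem
    rw [Unitary.conjStarAlgAut_apply] at hsp
    exact ⟨hH.eigenvectorUnitary.1, hH.eigenvalues, Unitary.coe_star_mul_self hH.eigenvectorUnitary,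
      fun i => hS.eigenvalues_pos i, hsp⟩
  refine ⟨U * Matrix.diagonal fun i => (√(e i))⁻¹, ?_⟩
  rw [hsp, Matrix.transpose_mul, Matrix.diagonal_transpose]
  set E := Matrix.diagonal fun i => (√(e i))⁻¹
  set D := Matrix.diagonal e
  have h1 : E * U.transpose * (U * D * U.transpose) * (U * E)
      = E * (U.transpose * U) * D * (U.transpose * U) * E := by
    simp only [Matrix.mul_assoc]
  rw [h1, hU, Matrix.mul_one, Matrix.mul_one, Matrix.diagonal_mul_diagonal,
    Matrix.diagonal_mul_diagonal, ← Matrix.diagonal_one]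
  congr 1
  ext i
  have h2 := Real.mul_self_sqrt (hpos i).le
  have h3 := (Real.sqrt_pos.2 (hpos i)).ne'
  field_simp
  rw [sq]
  exact h2.symm

/-- The map is the quadratic polynomial Ψ(z) = y + Az - ½ Γ(Az, Az), with Γ the Christoffel symbols
at `y` and Aᵀ G(y) A = 1. -/
theorem exists_isNormalMap (hG : ∀ z i j, G z i j = G z j i) (hpos : (G y).PosDef) :
    ∃ A Ψ, IsNormalMap G y A Ψ := by
  obtain ⟨A, hA⟩ := exists_congr_eq_one hpos
  let l : Fin n → EuclideanSpace ℝ (Fin n) → ℝ := fun a z => ∑ i, A a i * z i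
  have hco : ∀ i, ContDiff ℝ ∞ fun z : EuclideanSpace ℝ (Fin n) => z i := fun i =>
    (EuclideanSpace.proj (𝕜 := ℝ) i).contDiff
  have hl : ∀ a, ContDiff ℝ ∞ (l a) := fun a =>
    ContDiff.sum fun i _ => contDiff_const.mul (hco i)
  have hpco : ∀ i j z, pd i (fun z : EuclideanSpace ℝ (Fin n) => z j) z = if j = i then 1 else 0 := by
    intro i j z
    have : fderiv ℝ (fun z : EuclideanSpace ℝ (Fin n) => z j) z = EuclideanSpace.proj (𝕜 := ℝ) j :=
      (EuclideanSpace.proj (𝕜 := ℝ) j).fderiv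
    simp [pd, this]
  have hpl : ∀ i a z, pd i (l a) z = A a i := by
    intro i a z
    change pd i (fun z => ∑ i, A a i * z i) z = _
    rw [pd_sum i _ fun j => contDiffAt_const.mul (hco j).contDiffAt]
    simp_rw [pd_const_mul i _ (hco _).contDiffAt, hpco]
    simp
  let q : Fin n → EuclideanSpace ℝ (Fin n) → ℝ :=
    fun k z => ∑ a, ∑ b, christoffel G k a b y * (l a z * l b z)
  have hq : ∀ k, ContDiff ℝ ∞ (q k) := fun k =>
    ContDiff.sum fun a _ => ContDiff.sum fun b _ => contDiff_const.mul ((hl a).mul (hl b))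
  have hpq : ∀ k i z, pd i (q k) z
      = ∑ a, ∑ b, christoffel G k a b y * (A a i * l b z + l a z * A b i) := by
    intro k i z
    have h1 := fun a b => (contDiff_const (c := christoffel G k a b y)).mul ((hl a).mul (hl b))
    change pd i (fun z => ∑ a, ∑ b, christoffel G k a b y * (l a z * l b z)) z = _
    rw [pd_sum i _ fun a => (ContDiff.sum fun b _ => h1 a b).contDiffAt]
    simp_rw [pd_sum i _ fun b => (h1 _ b).contDiffAt,
      pd_const_mul i _ ((hl _).mul (hl _)).contDiffAt,
      pd_mul i (hl _).contDiffAt (hl _).contDiffAt, hpl]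
  have hppq : ∀ k i j z, pd j (pd i (q k)) z
      = ∑ a, ∑ b, christoffel G k a b y * (A a i * A b j + A a j * A b i) := by
    intro k i j z
    rw [show pd i (q k) = _ from funext (hpq k i)]
    have h0 := fun a b => ((contDiff_const (c := A a i)).mul (hl b)).add
      ((hl a).mul (contDiff_const (c := A b i)))
    have h1 := fun a b => (contDiff_const (c := christoffel G k a b y)).mul (h0 a b)
    rw [pd_sum j _ fun a => (ContDiff.sum fun b _ => h1 a b).contDiffAt]
    simp_rw [pd_sum j _ fun b => (h1 _ b).contDiffAt,
      pd_const_mul j _ (h0 _ _).contDiffAt,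
      pd_add j (contDiff_const.mul (hl _)).contDiffAt ((hl _).mul contDiff_const).contDiffAt,
      pd_mul j (hl _).contDiffAt contDiffAt_const, pd_const_mul j _ (hl _).contDiffAt, pd_const,
      hpl, mul_zero, add_zero]
  let ψ : Fin n → EuclideanSpace ℝ (Fin n) → ℝ := fun k z => (y k + l k z) - 1 / 2 * q k z
  have hψ : ∀ k, ContDiff ℝ ∞ (ψ k) := fun k =>
    (contDiff_const.add (hl k)).sub (contDiff_const.mul (hq k))
  have hpψ : ∀ k i z, pd i (ψ k) z = A k i - 1 / 2 * pd i (q k) z := by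
    intro k i z
    change pd i (fun z => (y k + l k z) - 1 / 2 * q k z) z = _
    rw [pd_sub i (contDiff_const.add (hl k)).contDiffAt (contDiff_const.mul (hq k)).contDiffAt,
      pd_add i contDiffAt_const (hl k).contDiffAt, pd_const_mul i _ (hq k).contDiffAt, pd_const,
      hpl, zero_add]
  refine ⟨A, fun z => WithLp.toLp 2 fun k => ψ k z, contDiff_euclidean.2 fun k => hψ k, ?_, hA,
    fun k i => ?_, fun k i j => ?_⟩
  · ext k
    simp [ψ, q, l]
  · change pd i (ψ k) 0 = _
    rw [hpψ, hpq]
    simp [l]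
  · change pd j (pd i (ψ k)) 0 = _
    rw [show pd i (ψ k) = _ from funext (hpψ k i),
      pd_sub j contDiffAt_const (contDiffAt_const.mul (contDiffAt_pd i (hq k).contDiffAt)),
      pd_const, pd_const_mul j _ (contDiffAt_pd i (hq k).contDiffAt), hppq]
    -- By symmetry of Γ both halves of the second derivative of the quadratic form agree, which
    -- absorbs the factor ½.
    have h1 : ∑ a, ∑ b, christoffel G k a b y * (A a i * A b j)
        = ∑ a, ∑ b, christoffel G k a b y * (A a j * A b i) := by
      rw [Finset.sum_comm]
      refine Finset.sum_congr rfl fun a _ => Finset.sum_congr rfl fun b _ => ?_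
      rw [christoffel_symm hG]
      ring
    simp only [mul_add, Finset.sum_add_distrib, h1]
    simp only [mul_assoc]
    ring

namespace IsNormalMap

theorem isUnit (hΨ : IsNormalMap G y A Ψ) : IsUnit A.det := by
  have h := congrArg Matrix.det hΨ.congr_eq_one
  rw [Matrix.det_mul, Matrix.det_one] at h
  exact IsUnit.of_mul_eq_one_right _ h

theorem inv_eq (hΨ : IsNormalMap G y A Ψ) : (G y)⁻¹ = A * A.transpose := by
  refine Matrix.inv_eq_left_inv ?_
  have h : A * (A.transpose * G y) = 1 := mul_eq_one_comm.1 hΨ.congr_eq_one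
  rw [Matrix.mul_assoc, h]

theorem tendsto (hΨ : IsNormalMap G y A Ψ) : Tendsto Ψ (𝓝 0) (𝓝 y) := by
  simpa [hΨ.map_zero] using hΨ.smooth.continuous.tendsto 0

theorem smooth_coord (hΨ : IsNormalMap G y A Ψ) (k : Fin n) : SmoothNear (fun z => Ψ z k) 0 :=
  Eventually.of_forall fun _ => (contDiff_euclidean.1 hΨ.smooth k).contDiffAt

theorem smoothNear_comp (hΨ : IsNormalMap G y A Ψ) (hv : SmoothNear v y) :
    SmoothNear (fun z => v (Ψ z)) 0 := by
  filter_upwards [hΨ.tendsto.eventually hv] with z hz using hz.comp z hΨ.smooth.contDiffAt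

theorem pd_comp_eq (hΨ : IsNormalMap G y A Ψ) (hv : SmoothNear v y) (i : Fin n) :
    pd i (fun z => v (Ψ z)) 0 = ∑ k, pd k v y * A k i := by
  rw [pd_comp i (by rw [hΨ.map_zero]; exact hv.contDiffAt) hΨ.smooth.contDiffAt, hΨ.map_zero]
  simp_rw [hΨ.pd_eq]

/-- The second derivative of `Ψ` at `0` supplies exactly the Christoffel correction, so plain second
derivatives of the composite are the Hessian of `v` transformed by `A`. -/
theorem pd_pd_comp_eq (hΨ : IsNormalMap G y A Ψ) (hv : SmoothNear v y) (i j : Fin n) :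
    pd j (pd i (fun z => v (Ψ z))) 0 = ∑ a, ∑ b, hessian G v a b y * A a j * A b i := by
  have hΨk := hΨ.smooth_coord
  have h1 := fun k => (hΨ.smoothNear_comp (hv.pd k)).mul ((hΨk k).pd i)
  have h2 : pd i (fun z => v (Ψ z)) =ᶠ[𝓝 0]
      fun z => ∑ k, pd k v (Ψ z) * pd i (fun z => Ψ z k) z := by
    filter_upwards [hΨ.tendsto.eventually hv] with z hz
    exact pd_comp i hz hΨ.smooth.contDiffAt
  have h3 : ∀ k, pd j (fun z => pd k v (Ψ z) * pd i (fun z => Ψ z k) z) 0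
      = (∑ l, pd l (pd k v) y * A l j) * A k i
        + pd k v y * -∑ a, ∑ b, christoffel G k a b y * A a j * A b i := by
    intro k
    rw [pd_mul j (hΨ.smoothNear_comp (hv.pd k)).contDiffAt ((hΨk k).pd i).contDiffAt,
      hΨ.pd_comp_eq (hv.pd k), hΨ.pd_eq, hΨ.pd_pd_eq, hΨ.map_zero]
  rw [pd_congr j h2, pd_sum j _ fun k => (h1 k).contDiffAt]
  simp_rw [h3, hessian, Finset.sum_add_distrib, sub_mul, Finset.sum_mul, Finset.sum_sub_distrib,
    mul_neg, Finset.sum_neg_distrib, Finset.mul_sum, ← sub_eq_add_neg]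
  congr 1
  · exact Finset.sum_comm
  · rw [Finset.sum_comm]
    refine Finset.sum_congr rfl fun a _ => ?_
    rw [Finset.sum_comm]
    refine Finset.sum_congr rfl fun b _ => Finset.sum_congr rfl fun k _ => ?_
    ring

/-- At first order the pulled-back metric has derivative ∂_c g_ab - Γ_b,ca - Γ_a,cb contracted with
three copies of `A`. This is zero because the Levi-Civita connection is metric. -/
theorem isNormalAt (hΨ : IsNormalMap G y A Ψ) (hG : ∀ i j, SmoothNear (fun z => G z i j) y)
    (hsymm : ∀ z i j, G z i j = G z j i) (hsymm' : ∀ z i j, G' z i j = G' z j i)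
    (h : ∀ᶠ z in 𝓝 0, ∀ i j, G' z i j
      = ∑ a, ∑ b, G (Ψ z) a b * (pd i (fun z => Ψ z a) z * pd j (fun z => Ψ z b) z)) :
    IsNormalAt G' 0 := by
  have hΨk := hΨ.smooth_coord
  have h1 : ∀ i j, (fun z => G' z i j) =ᶠ[𝓝 0] fun z => ∑ a, ∑ b, G (Ψ z) a b
      * (pd i (fun z => Ψ z a) z * pd j (fun z => Ψ z b) z) := by
    intro i j
    filter_upwards [h] with z hz using hz i j
  have h2 := fun i j a b => ((hΨk a).pd i).mul ((hΨk b).pd j)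
  have h3 := fun i j a b => (hΨ.smoothNear_comp (hG a b)).mul (h2 i j a b)
  refine ⟨fun i j => ?_, hsymm', ?_, fun k i j => ?_⟩
  · exact SmoothNear.congr (.sum fun a => .sum fun b => h3 i j a b) (h1 i j).symm
  · rw [← hΨ.congr_eq_one]
    ext i j
    refine (h1 i j).self_of_nhds.trans ?_
    simp_rw [hΨ.pd_eq, hΨ.map_zero, Matrix.mul_apply, Finset.sum_mul, Matrix.transpose_apply]
    rw [Finset.sum_comm]
    exact Finset.sum_congr rfl fun a _ => Finset.sum_congr rfl fun b _ => by ring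
  · have hdet : IsUnit (G y).det := by
      have h := congrArg Matrix.det hΨ.congr_eq_one
      rw [Matrix.det_mul, Matrix.det_mul, Matrix.det_one, mul_right_comm] at h
      exact IsUnit.of_mul_eq_one_right _ h
    have h4 : ∀ a b, pd k (fun z => G (Ψ z) a b
        * (pd i (fun z => Ψ z a) z * pd j (fun z => Ψ z b) z)) 0
        = (∑ c, pd c (fun z => G z a b) y * A c k) * (A a i * A b j)
          + G y a b * ((-∑ c, ∑ d, christoffel G a c d y * A c k * A d i) * A b j
            + A a i * -∑ c, ∑ d, christoffel G b c d y * A c k * A d j) := by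
      intro a b
      rw [pd_mul k (hΨ.smoothNear_comp (hG a b)).contDiffAt (h2 i j a b).contDiffAt,
        pd_mul k ((hΨk a).pd i).contDiffAt ((hΨk b).pd j).contDiffAt, hΨ.pd_comp_eq (hG a b)]
      simp_rw [hΨ.pd_eq, hΨ.pd_pd_eq, hΨ.map_zero]
    rw [pd_congr k (h1 i j), pd_sum k _ fun a => (SmoothNear.sum fun b => h3 i j a b).contDiffAt]
    simp_rw [pd_sum k _ fun b => (h3 i j _ b).contDiffAt, h4]
    have hlow : ∀ b i, ∑ a, G y a b * ∑ c, ∑ d, christoffel G a c d y * A c k * A d i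
        = ∑ c, ∑ d, 1 / 2 * christoffelLower G b c d y * (A c k * A d i) := by
      intro b i
      simp_rw [← sum_mul_christoffel hsymm hdet, Finset.mul_sum, Finset.sum_mul]
      rw [Finset.sum_comm]
      refine Finset.sum_congr rfl fun c _ => ?_
      rw [Finset.sum_comm]
      exact Finset.sum_congr rfl fun d _ => Finset.sum_congr rfl fun a _ => by ring
    have h5 : ∑ a, ∑ b, G y a b * ((∑ c, ∑ d, christoffel G a c d y * A c k * A d i) * A b j)
        = ∑ a, ∑ b, ∑ c, 1 / 2 * christoffelLower G b c a y * (A c k * A a i * A b j) := by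
      rw [Finset.sum_comm, Finset.sum_comm (γ := Fin n) (f := fun a b => ∑ c, _)]
      refine Finset.sum_congr rfl fun b _ => ?_
      simp_rw [← mul_assoc, ← Finset.sum_mul, hlow, Finset.sum_mul]
      rw [Finset.sum_comm]
      exact Finset.sum_congr rfl fun b _ => Finset.sum_congr rfl fun c _ => by ring
    have h6 : ∑ a, ∑ b, G y a b * (A a i * ∑ c, ∑ d, christoffel G b c d y * A c k * A d j)
        = ∑ a, ∑ b, ∑ c, 1 / 2 * christoffelLower G a c b y * (A c k * A a i * A b j) := by
      refine Finset.sum_congr rfl fun a _ => ?_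
      simp_rw [mul_left_comm (G y a _), ← Finset.mul_sum, hsymm y a, hlow, Finset.mul_sum]
      rw [Finset.sum_comm]
      exact Finset.sum_congr rfl fun b _ => Finset.sum_congr rfl fun c _ => by ring
    simp only [mul_add, mul_neg, neg_mul, Finset.sum_add_distrib, Finset.sum_neg_distrib, h5, h6]
    simp only [Finset.sum_mul]
    rw [← neg_add, ← sub_eq_add_neg, sub_eq_zero]
    simp_rw [← Finset.sum_add_distrib]
    refine Finset.sum_congr rfl fun a _ => Finset.sum_congr rfl fun b _ =>
      Finset.sum_congr rfl fun c _ => ?_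
    have hab : (fun z => G z b a) = fun z => G z a b := funext fun z => hsymm z b a
    simp only [christoffelLower, hab]
    ring

/-- The Laplacian of a function in the new coordinates. -/
theorem sum_pd_pd_comp_eq (hΨ : IsNormalMap G y A Ψ) (hv : SmoothNear v y) :
    ∑ j, pd j (pd j (fun z => v (Ψ z))) 0 = ∑ a, ∑ b, (G y)⁻¹ a b * hessian G v a b y := by
  simp_rw [hΨ.pd_pd_comp_eq hv, hΨ.inv_eq, Matrix.mul_apply, Finset.sum_mul]
  rw [Finset.sum_comm]
  refine Finset.sum_congr rfl fun a _ => ?_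
  rw [Finset.sum_comm]
  refine Finset.sum_congr rfl fun b _ => Finset.sum_congr rfl fun j _ => ?_
  rw [Matrix.transpose_apply]
  ring

end IsNormalMap

end RiemCoord

/-! ### Passage to arbitrary coordinates; the Laplacian -/

namespace RiemCoord

open Filter Topology

variable {n : ℕ} {F L : EuclideanSpace ℝ (Fin n) → ℝ} {y : EuclideanSpace ℝ (Fin n)}
  {G G' : EuclideanSpace ℝ (Fin n) → Matrix (Fin n) (Fin n) ℝ}
  {Ψ : EuclideanSpace ℝ (Fin n) → EuclideanSpace ℝ (Fin n)} {A : Matrix (Fin n) (Fin n) ℝ}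
  {m s : ℝ}

/-- The identity of `IsNormalAt.ricci_grad` in arbitrary coordinates. -/
theorem IsNormalMap.ricci_grad (hΨ : IsNormalMap G y A Ψ) (hN : IsNormalAt G' 0)
    (hE : EinsteinNear G F L m s y)
    (hE' : EinsteinNear G' (fun z => F (Ψ z)) (fun z => L (Ψ z)) m s 0) (hm : m ≠ 0)
    (hF : F y ≠ 0) (hG : IsUnit (G y).det) (j : Fin n) :
    (m - 1) * ∑ a, ricci G j a y * ∑ b, (G y)⁻¹ a b * pd b F y
      = pd j (fun z => (((n : ℝ) - 1) * L z - s) * F z) y := by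
  let R : Matrix (Fin n) (Fin n) ℝ := .of fun i j => ricci G i j y
  let R' : Matrix (Fin n) (Fin n) ℝ := .of fun i j => ricci G' i j 0
  let H : Matrix (Fin n) (Fin n) ℝ := .of fun i j => hessian G F i j y
  let d : Fin n → ℝ := fun i => pd i F y
  let dW : Fin n → ℝ := fun i => pd i (fun z => (((n : ℝ) - 1) * L z - s) * F z) y
  have hW : SmoothNear (fun z => (((n : ℝ) - 1) * L z - s) * F z) y :=
    (((SmoothNear.const _).mul hE.smooth_L).sub (.const _)).mul hE.smooth_F
  have h1 : (m - 1) • R'.mulVec (A.transpose.mulVec d) = A.transpose.mulVec dW := by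
    ext i
    have h := hN.ricci_grad hE' hm i
    rw [hΨ.pd_comp_eq hW] at h
    simp_rw [hΨ.pd_comp_eq hE.smooth_F] at h
    simp only [Pi.smul_apply, smul_eq_mul, Matrix.mulVec, dotProduct, Matrix.transpose_apply, R', d,
      dW, Matrix.of_apply]
    simpa only [mul_comm] using h
  -- The equation itself expresses `F • Ric` through the Hessian, whose behaviour under `Ψ` is
  -- known. No transformation law for the Ricci tensor is needed, at the price of dividing by `F y`
  -- at the end.
  have h2 : F y • R' = m • (A.transpose * H * A) + (L y * F y) • (1 : Matrix _ _ ℝ) := by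
    ext i j
    have h := hE'.equation.self_of_nhds i j
    rw [hN.hessian_eq, hΨ.pd_pd_comp_eq hE.smooth_F, hN.eq_one, hΨ.map_zero] at h
    have h3 : (A.transpose * H * A) i j = ∑ a, ∑ b, hessian G F a b y * A a i * A b j := by
      simp_rw [Matrix.mul_apply, Finset.sum_mul, Matrix.transpose_apply]
      rw [Finset.sum_comm]
      exact Finset.sum_congr rfl fun a _ => Finset.sum_congr rfl fun b _ => by
        simp only [H, Matrix.of_apply]; ring
    simp only [Matrix.add_apply, Matrix.smul_apply, smul_eq_mul, h3, h, R', Matrix.of_apply]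
    field_simp
    ring
  have h3 : m • H = F y • (R - L y • G y) := by
    ext i j
    have h := hE.equation.self_of_nhds i j
    simp only [Matrix.sub_apply, Matrix.smul_apply, smul_eq_mul, R, H, Matrix.of_apply, h]
    field_simp
  have h4 : A.transpose.mulVec ((m - 1) • (m • H * (A * A.transpose)).mulVec d
      + ((m - 1) * (L y * F y)) • d) = A.transpose.mulVec (F y • dW) := by
    rw [Matrix.mulVec_smul, ← h1, smul_comm, ← Matrix.smul_mulVec (F y), h2]
    simp only [Matrix.mulVec_add, Matrix.mulVec_smul, Matrix.add_mulVec, Matrix.smul_mulVec,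
      Matrix.mulVec_mulVec, Matrix.smul_mul, Matrix.add_mul, smul_add, smul_smul,
      Matrix.mul_assoc, Matrix.one_mul]
  have h5 := Matrix.mulVec_injective_of_isUnit
    ((Matrix.isUnit_iff_isUnit_det _).2 (Matrix.isUnit_det_transpose _ hΨ.isUnit)) h4
  rw [← hΨ.inv_eq, h3, Matrix.smul_mul, Matrix.sub_mul, Matrix.smul_mul, Matrix.mul_nonsing_inv _ hG]
    at h5
  have h6 : F y • ((m - 1) • (R * (G y)⁻¹).mulVec d) = F y • dW := by
    rw [← h5, Matrix.smul_mulVec, Matrix.sub_mulVec, Matrix.smul_mulVec, Matrix.one_mulVec]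
    module
  have h7 := congrFun (smul_right_injective _ hF h6) j
  rw [← Matrix.mulVec_mulVec] at h7
  exact h7

/-! ### The Laplacian and the strong maximum principle -/

/-- The Laplacian, the trace of the Hessian. -/
noncomputable def laplacian (G : EuclideanSpace ℝ (Fin n) → Matrix (Fin n) (Fin n) ℝ)
    (F : EuclideanSpace ℝ (Fin n) → ℝ) (y : EuclideanSpace ℝ (Fin n)) : ℝ :=
  ∑ i, ∑ j, (G y)⁻¹ i j * hessian G F i j y

/-- Restrict to a coordinate line. A positive second derivative would make the point also a local
minimum, so the restriction would be locally constant with zero second derivative. -/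
theorem pd_pd_nonpos_of_isLocalMax (hF : SmoothNear F y) (h : IsLocalMax F y) (i : Fin n) :
    pd i (pd i F) y ≤ 0 := by
  let γ : ℝ → EuclideanSpace ℝ (Fin n) := fun r => y + r • EuclideanSpace.single i 1
  have hγ : ∀ r, HasDerivAt γ (EuclideanSpace.single i 1) r := fun r => by
    have h := ((hasDerivAt_id r).smul_const (EuclideanSpace.single i (1 : ℝ))).const_add y
    rwa [one_smul] at h
  have hγ0 : γ 0 = y := by simp [γ]
  have hγt : Tendsto γ (𝓝 0) (𝓝 y) := by simpa [hγ0] using (hγ 0).continuousAt.tendsto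
  have hd : ∀ {H : EuclideanSpace ℝ (Fin n) → ℝ} {r : ℝ}, ContDiffAt ℝ ∞ H (γ r) →
      deriv (fun r => H (γ r)) r = pd i H (γ r) := fun hH =>
    ((hH.differentiableAt (by simp)).hasFDerivAt.comp_hasDerivAt _ (hγ _)).deriv
  have h1 : deriv (fun r => F (γ r)) =ᶠ[𝓝 0] fun r => pd i F (γ r) := by
    filter_upwards [hγt.eventually hF] with r hr using hd hr
  have h2 : deriv (deriv fun r => F (γ r)) 0 = pd i (pd i F) y := by
    rw [h1.deriv_eq, hd (by rw [hγ0]; exact contDiffAt_pd i hF.contDiffAt), hγ0]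
  have hmax : IsLocalMax (fun r => F (γ r)) 0 := by
    have := hγt.eventually h
    simpa only [IsLocalMax, IsMaxFilter, hγ0] using this
  by_contra! hpos
  rw [← h2] at hpos
  have hcont : ContinuousAt (fun r => F (γ r)) 0 :=
    ContinuousAt.comp (f := γ) (g := F) (by rw [hγ0]; exact hF.contDiffAt.continuousAt)
      (hγ 0).continuousAt
  have hmin := isLocalMin_of_deriv_deriv_pos hpos hmax.deriv_eq_zero hcont
  have hconst : (fun r => F (γ r)) =ᶠ[𝓝 0] fun _ => F (γ 0) := by
    filter_upwards [hmax, hmin] with r h3 h4 using le_antisymm h3 h4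
  have h5 : deriv (fun r => F (γ r)) =ᶠ[𝓝 0] fun _ => 0 := by
    filter_upwards [hconst.eventuallyEq_nhds] with r hr
    rw [hr.deriv_eq, deriv_const]
  rw [h5.deriv_eq, deriv_const] at hpos
  exact lt_irrefl _ hpos

/-- After composing with a normal map, the Laplacian is a sum of pure second derivatives. -/
theorem laplacian_nonpos_of_isLocalMax (hG : ∀ z i j, G z i j = G z j i) (hpos : (G y).PosDef)
    (hF : SmoothNear F y) (h : IsLocalMax F y) : laplacian G F y ≤ 0 := by
  obtain ⟨A, Ψ, hΨ⟩ := exists_isNormalMap hG hpos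
  rw [laplacian, ← hΨ.sum_pd_pd_comp_eq hF]
  refine Finset.sum_nonpos fun j _ => pd_pd_nonpos_of_isLocalMax (hΨ.smoothNear_comp hF) ?_ j
  have := hΨ.tendsto.eventually h
  simpa only [IsLocalMax, IsMaxFilter, hΨ.map_zero] using this

theorem SmoothNear.laplacian (hG : ∀ i j, SmoothNear (fun z => G z i j) y)
    (h : IsUnit (G y).det) (hF : SmoothNear F y) : SmoothNear (laplacian G F) y :=
  .sum fun i => .sum fun j => .mul (.matrix_inv hG h i j) (.hessian hG h hF i j)

theorem laplacian_add (hF : SmoothNear F y) (hL : SmoothNear L y) :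
    laplacian G (fun z => F z + L z) y = laplacian G F y + laplacian G L y := by
  have h1 : ∀ i j, hessian G (fun z => F z + L z) i j y = hessian G F i j y + hessian G L i j y := by
    intro i j
    have h2 : pd j (fun z => F z + L z) =ᶠ[𝓝 y] fun z => pd j F z + pd j L z := by
      filter_upwards [hF, hL] with z h3 h4 using pd_add j h3 h4
    simp only [hessian]
    rw [pd_congr i h2, pd_add i (hF.pd j).contDiffAt (hL.pd j).contDiffAt]
    simp_rw [pd_add _ hF.contDiffAt hL.contDiffAt, mul_add, Finset.sum_add_distrib]
    ring
  simp only [laplacian, h1, mul_add, Finset.sum_add_distrib]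

theorem laplacian_const_mul (c : ℝ) (hF : SmoothNear F y) :
    laplacian G (fun z => c * F z) y = c * laplacian G F y := by
  have h1 : ∀ i j, hessian G (fun z => c * F z) i j y = c * hessian G F i j y := by
    intro i j
    have h2 : pd j (fun z => c * F z) =ᶠ[𝓝 y] fun z => c * pd j F z := by
      filter_upwards [hF] with z h3 using pd_const_mul j c h3
    simp only [hessian]
    rw [pd_congr i h2, pd_const_mul i c (hF.pd j).contDiffAt]
    simp_rw [pd_const_mul _ c hF.contDiffAt, mul_sub, Finset.mul_sum]
    congr 1
    exact Finset.sum_congr rfl fun k _ => by ring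
  simp only [laplacian, h1, Finset.mul_sum]
  exact Finset.sum_congr rfl fun i _ => Finset.sum_congr rfl fun k _ => by ring

theorem laplacian_mul_self (hF : SmoothNear F y) (h : F y = 0) :
    laplacian G (fun z => F z * F z) y
      = 2 * ∑ i, ∑ j, (G y)⁻¹ i j * (pd i F y * pd j F y) := by
  have h1 : ∀ i j, hessian G (fun z => F z * F z) i j y = 2 * (pd i F y * pd j F y) := by
    intro i j
    simp only [hessian]
    rw [pd_pd_mul i j hF hF]
    simp_rw [pd_mul _ hF.contDiffAt hF.contDiffAt, h]
    simp
    ring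
  simp only [laplacian, h1, Finset.mul_sum]
  exact Finset.sum_congr rfl fun i _ => Finset.sum_congr rfl fun k _ => by ring

end RiemCoord

/-! ### Hopf's barrier and the strong maximum principle -/

namespace RiemCoord

open Filter Topology

variable {n : ℕ} {F : EuclideanSpace ℝ (Fin n) → ℝ} {y : EuclideanSpace ℝ (Fin n)}
  {G : EuclideanSpace ℝ (Fin n) → Matrix (Fin n) (Fin n) ℝ} {c : ℝ}

/-- There is no strict upper barrier at a point where a subharmonic function attains its maximum. -/
theorem false_of_barrier {x : EuclideanSpace ℝ (Fin n)} (hsymm : ∀ z i j, G z i j = G z j i)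
    (hpos : ∀ᶠ z in 𝓝 x, (G z).PosDef) {φ : EuclideanSpace ℝ (Fin n) → ℝ} (hF : SmoothNear F x)
    (hφ : SmoothNear φ x) (hFx : F x = c) (hle : ∀ᶠ z in 𝓝 x, F z ≤ c)
    (hL : ∀ᶠ z in 𝓝 x, 0 ≤ laplacian G F z) (hφL : ∀ᶠ z in 𝓝 x, 0 < laplacian G φ z)
    (hφx : φ x = 0) (hlt : ∀ᶠ z in 𝓝 x, z ≠ x → 0 ≤ φ z → F z < c) : False := by
  obtain ⟨r, hr, hball⟩ := Metric.nhds_basis_closedBall.eventually_iff.1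
    ((((((hpos.and hle).and hL).and hφL).and hlt).and hF.eventually).and hφ.eventually)
  have hFc : ContinuousOn F (Metric.closedBall x r) := fun z hz =>
    (hball hz).1.2.contDiffAt.continuousAt.continuousWithinAt
  have hφc : ContinuousOn φ (Metric.closedBall x r) := fun z hz =>
    (hball hz).2.contDiffAt.continuousAt.continuousWithinAt
  have hsub : Metric.sphere x r ⊆ Metric.closedBall x r := Metric.sphere_subset_closedBall
  have hcpt : IsCompact {z ∈ Metric.sphere x r | 0 ≤ φ z} := by
    refine (isCompact_sphere x r).of_isClosed_subset ?_ fun z hz => hz.1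
    exact (hφc.mono hsub).preimage_isClosed_of_isClosed Metric.isClosed_sphere isClosed_Ici
  -- On the compact part of the sphere where `φ ≥ 0`, `F` stays below `c` by a definite margin, so a
  -- small multiple of `φ` can be added. Where `φ < 0`, the bound `F ≤ c` already suffices. The
  -- perturbed function thus attains its maximum inside the ball, although its Laplacian is positive
  -- there.
  obtain ⟨ε, hε, hεlt⟩ : ∃ ε > 0, ∀ z ∈ {z ∈ Metric.sphere x r | 0 ≤ φ z}, F z + ε * φ z < c := by
    have hne : ∀ z ∈ {z ∈ Metric.sphere x r | 0 ≤ φ z}, F z < c := fun z hz =>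
      (hball (hsub hz.1)).1.1.2 (ne_of_mem_of_not_mem hz.1 (by simp [hr.ne])) hz.2
    rcases Set.eq_empty_or_nonempty {z ∈ Metric.sphere x r | 0 ≤ φ z} with h0 | h0
    · exact ⟨1, one_pos, fun z hz => absurd hz (h0 ▸ Set.notMem_empty z)⟩
    obtain ⟨z1, hz1, hmax1⟩ := hcpt.exists_isMaxOn h0 (hFc.mono fun z hz => hsub hz.1)
    obtain ⟨z2, hz2, hmax2⟩ := hcpt.exists_isMaxOn h0 (hφc.mono fun z hz => hsub hz.1)
    have h1 := hne z1 hz1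
    have h2 : 0 ≤ φ z2 := hz2.2
    -- The `+ 1` keeps the denominator positive when `φ` has maximum zero.
    refine ⟨(c - F z1) / (φ z2 + 1), div_pos (by linarith) (by linarith), fun z hz => ?_⟩
    have h3 : F z ≤ F z1 := hmax1 hz
    have h4 : φ z ≤ φ z2 := hmax2 hz
    have h5 : (c - F z1) / (φ z2 + 1) * φ z < c - F z1 := by
      rw [div_mul_eq_mul_div, div_lt_iff₀ (by linarith)]
      nlinarith
    linarith
  have hu : ContinuousOn (fun z => F z + ε * φ z) (Metric.closedBall x r) :=
    hFc.add (continuousOn_const.mul hφc)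
  obtain ⟨p, hp, hmax⟩ := (isCompact_closedBall x r).exists_isMaxOn
    ⟨x, Metric.mem_closedBall_self hr.le⟩ hu
  have hxp : c ≤ F p + ε * φ p := by
    have := hmax (Metric.mem_closedBall_self hr.le)
    simpa [hFx, hφx] using this
  have hp' : p ∈ Metric.ball x r := by
    by_contra hpb
    have hps : p ∈ Metric.sphere x r :=
      le_antisymm hp (not_lt.1 hpb)
    by_cases h0 : 0 ≤ φ p
    · exact absurd (hεlt p ⟨hps, h0⟩) (not_lt.2 hxp)
    · have h1 := (hball hp).1.1.1.1.1.2
      have h2 := mul_neg_of_pos_of_neg hε (not_le.1 h0)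
      linarith
  have hloc : IsLocalMax (fun z => F z + ε * φ z) p :=
    hmax.isLocalMax (Metric.closedBall_mem_nhds_of_mem hp')
  obtain ⟨⟨⟨⟨⟨⟨h1, -⟩, h2⟩, h3⟩, -⟩, h4⟩, h5⟩ := hball hp
  have h6 := laplacian_nonpos_of_isLocalMax hsymm h1 (h4.add ((SmoothNear.const ε).mul h5)) hloc
  rw [laplacian_add h4 ((SmoothNear.const ε).mul h5), laplacian_const_mul ε h5] at h6
  have := mul_pos hε h3
  linarith

theorem pd_dist_sq (p : EuclideanSpace ℝ (Fin n)) (i : Fin n) (y : EuclideanSpace ℝ (Fin n)) :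
    pd i (fun z => dist z p ^ 2) y = 2 * (y i - p i) := by
  have h : HasFDerivAt (fun z => dist z p ^ 2)
      (2 • (innerSL ℝ (y - p)).comp (ContinuousLinearMap.id ℝ _)) y := by
    simp only [dist_eq_norm]
    exact ((hasFDerivAt_id y).sub_const p).norm_sq
  rw [pd, h.fderiv]
  simp [EuclideanSpace.inner_single_right]

theorem smoothNear_dist_sq (p y : EuclideanSpace ℝ (Fin n)) :
    SmoothNear (fun z => dist z p ^ 2) y := by
  simp only [dist_eq_norm]
  exact Eventually.of_forall fun z => ((contDiff_id.sub contDiff_const).norm_sq ℝ).contDiffAt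

theorem inv_quadratic_pos (hG : (G y).PosDef) {d : Fin n → ℝ} (hd : d ≠ 0) :
    0 < ∑ i, ∑ j, (G y)⁻¹ i j * (d i * d j) := by
  have := hG.inv.dotProduct_mulVec_pos hd
  simp only [dotProduct, Matrix.mulVec, Pi.star_apply, star_trivial, Finset.mul_sum] at this
  refine this.trans_eq (Finset.sum_congr rfl fun i _ => Finset.sum_congr rfl fun j _ => ?_)
  ring

/-- A subharmonic function cannot attain its maximum at a boundary point of a ball in which it
is strictly smaller, unless that point is on the boundary of the domain. -/
theorem false_of_touching_ball {x p : EuclideanSpace ℝ (Fin n)}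
    (hsymm : ∀ z i j, G z i j = G z j i) (hG : ∀ i j, SmoothNear (fun z => G z i j) x)
    (hpos : ∀ᶠ z in 𝓝 x, (G z).PosDef) (hF : SmoothNear F x)
    (hFx : F x = c) (hle : ∀ᶠ z in 𝓝 x, F z ≤ c) (hL : ∀ᶠ z in 𝓝 x, 0 ≤ laplacian G F z)
    (hxp : x ≠ p) (hball : ∀ᶠ z in 𝓝 x, dist z p < dist x p → F z < c) : False := by
  have hGx := hpos.self_of_nhds
  have hdet : IsUnit (G x).det := (Matrix.isUnit_iff_isUnit_det _).1 hGx.isUnit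
  -- `t` is positive exactly inside the ball around `p` through `x`, and its gradient at `x` is
  -- nonzero.
  let t : EuclideanSpace ℝ (Fin n) → ℝ := fun z => dist x p ^ 2 + (-1) * dist z p ^ 2
  have ht : SmoothNear t x := (SmoothNear.const _).add ((SmoothNear.const _).mul
    (smoothNear_dist_sq p x))
  have htx : t x = 0 := by simp [t]
  have hdt : ∀ i, pd i t x = -2 * (x i - p i) := by
    intro i
    change pd i (fun z => dist x p ^ 2 + (-1) * dist z p ^ 2) x = _
    have hs := (smoothNear_dist_sq p x).contDiffAt
    rw [pd_add i contDiffAt_const (contDiffAt_const.mul hs), pd_const, pd_const_mul i _ hs,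
      pd_dist_sq]
    ring
  have hq : 0 < ∑ i, ∑ j, (G x)⁻¹ i j * (pd i t x * pd j t x) := by
    refine inv_quadratic_pos hGx fun h0 => hxp ?_
    ext i
    have := congrFun h0 i
    rw [hdt] at this
    simp only [Pi.zero_apply] at this
    linarith
  set q := ∑ i, ∑ j, (G x)⁻¹ i j * (pd i t x * pd j t x)
  -- At `x` the Laplacian of `t²` is `2 * q > 0`, so a multiple of it outweighs the remaining terms.
  obtain ⟨K, hK⟩ : ∃ K : ℝ, 0 < laplacian G t x + K * (2 * q)
      + (-1) * laplacian G (fun z => dist z x ^ 2) x := by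
    refine ⟨(1 - laplacian G t x + laplacian G (fun z => dist z x ^ 2) x) / (2 * q), ?_⟩
    rw [div_mul_cancel₀ _ (by positivity)]
    linarith
  -- Subtracting the squared distance to `x` makes `φ ≥ 0` near `x`, away from `x` itself, force `t
  -- > 0`, i.e. force the point into the open ball.
  let φ : EuclideanSpace ℝ (Fin n) → ℝ := fun z => (t z + K * (t z * t z)) + (-1) * dist z x ^ 2
  have h1 := (SmoothNear.const K).mul (ht.mul ht)
  have h2 := (SmoothNear.const (-1)).mul (smoothNear_dist_sq x x)
  have hφ : SmoothNear φ x := (ht.add h1).add h2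
  have hφL : 0 < laplacian G φ x := by
    change 0 < laplacian G (fun z => (t z + K * (t z * t z)) + (-1) * dist z x ^ 2) x
    rwa [laplacian_add (ht.add h1) h2, laplacian_add ht h1, laplacian_const_mul K (ht.mul ht),
      laplacian_mul_self ht htx, laplacian_const_mul _ (smoothNear_dist_sq x x)]
  have hsmall : ∀ᶠ z in 𝓝 x, 0 < 1 + K * t z := by
    have hc : ContinuousAt (fun z => 1 + K * t z) x :=
      continuousAt_const.add (continuousAt_const.mul ht.contDiffAt.continuousAt)
    exact hc.eventually (lt_mem_nhds (by simp [htx]))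
  refine false_of_barrier hsymm hpos hF hφ hFx hle hL
    ((SmoothNear.laplacian hG hdet hφ).contDiffAt.continuousAt.eventually (lt_mem_nhds hφL))
    (by simp [φ, htx]) ?_
  filter_upwards [hsmall, hball] with z hz hzb hzx hφz
  refine hzb (lt_of_pow_lt_pow_left₀ 2 dist_nonneg ?_)
  by_contra! hge
  have h3 : t z ≤ 0 := by simp only [t]; linarith
  have h4 : 0 < dist z x ^ 2 := by have := dist_pos.2 hzx; positivity
  have h5 : φ z = t z * (1 + K * t z) + (-1) * dist z x ^ 2 := by simp only [φ]; ring
  have h6 := mul_nonpos_of_nonpos_of_nonneg h3 hz.le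
  linarith

/-- The strong maximum principle: the set where a subharmonic function attains its maximum is
open. -/
theorem eventually_eq_of_subharmonic {U : Set (EuclideanSpace ℝ (Fin n))} (hU : IsOpen U)
    (hsymm : ∀ z i j, G z i j = G z j i) (hG : ∀ z ∈ U, ∀ i j, ContDiffAt ℝ ∞ (fun z => G z i j) z)
    (hpos : ∀ z ∈ U, (G z).PosDef) (hF : ∀ z ∈ U, ContDiffAt ℝ ∞ F z)
    (hle : ∀ z ∈ U, F z ≤ c) (hL : ∀ z ∈ U, 0 ≤ laplacian G F z) (hy : y ∈ U) (hFy : F y = c) :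
    ∀ᶠ z in 𝓝 y, F z = c := by
  by_contra hcon
  obtain ⟨r, hr, hball⟩ := Metric.nhds_basis_closedBall.mem_iff.1 (hU.mem_nhds hy)
  obtain ⟨p, hp, hpc⟩ : ∃ p ∈ Metric.ball y (r / 2), F p ≠ c := by
    by_contra! h
    exact hcon (Filter.mem_of_superset (Metric.ball_mem_nhds y (half_pos hr)) h)
  have hcpt : IsCompact {z ∈ Metric.closedBall y r | F z = c} := by
    refine (isCompact_closedBall y r).of_isClosed_subset ?_ fun z hz => hz.1
    have hc : ContinuousOn F (Metric.closedBall y r) := fun z hz =>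
      (hF z (hball hz)).continuousAt.continuousWithinAt
    exact hc.preimage_isClosed_of_isClosed Metric.isClosed_closedBall isClosed_singleton
  -- `x` is a point of the contact set nearest to `p`, so `F < c` in the part of the ball around `p`
  -- through `x` that lies near `x`.
  obtain ⟨x, hx, hmin⟩ := hcpt.exists_isMinOn ⟨y, Metric.mem_closedBall_self hr.le, hFy⟩
    (f := fun z => dist z p) (by fun_prop)
  have hxU : x ∈ U := hball hx.1
  have hev : ∀ᶠ z in 𝓝 x, z ∈ U := hU.mem_nhds hxU
  have hyp : dist y p < r / 2 := by simpa [dist_comm] using hp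
  have hxy : dist x p ≤ dist y p := hmin ⟨Metric.mem_closedBall_self hr.le, hFy⟩
  refine false_of_touching_ball (p := p) hsymm (fun i j => hev.mono fun z hz => hG z hz i j)
    (hev.mono hpos) (hev.mono hF) hx.2 (hev.mono hle) (hev.mono hL)
    (fun h => hpc (h ▸ hx.2)) ?_
  filter_upwards [hev] with z hz hzx
  refine lt_of_le_of_ne (hle z hz) fun hzc => ?_
  refine (not_lt.2 (hmin (a := z) ⟨?_, hzc⟩)) hzx
  -- Since `p` is within `r / 2` of `y` and `z` is closer to `p` than `y` is, `z` stays in the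
  -- closed ball where the distance was minimized.
  have := dist_triangle z p y
  rw [Metric.mem_closedBall]
  rw [dist_comm p y] at this
  linarith

end RiemCoord

open Filter Topology RiemCoord

/-! ### Functions and the metric read in charts -/

section Charts

variable {n : ℕ} {M : Type*} [TopologicalSpace M] [ChartedSpace (EuclideanSpace ℝ (Fin n)) M]
  {e : OpenPartialHomeomorph M (EuclideanSpace ℝ (Fin n))} {y : EuclideanSpace ℝ (Fin n)}

theorem contDiffAt_comp_symm (he : e ∈ IsManifold.maximalAtlas (𝓡 n) ∞ M) (hy : y ∈ e.target)
    {f : M → ℝ} (hf : ContMDiff (𝓡 n) 𝓘(ℝ, ℝ) ∞ f) : ContDiffAt ℝ ∞ (fun z => f (e.symm z)) y :=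
  contMDiffAt_iff_contDiffAt.1
    (hf.contMDiffAt.comp y (contMDiffAt_symm_of_mem_maximalAtlas he hy))

theorem smoothNear_comp_symm (he : e ∈ IsManifold.maximalAtlas (𝓡 n) ∞ M) (hy : y ∈ e.target)
    {f : M → ℝ} (hf : ContMDiff (𝓡 n) 𝓘(ℝ, ℝ) ∞ f) : SmoothNear (fun z => f (e.symm z)) y := by
  filter_upwards [e.open_target.mem_nhds hy] with z hz using contDiffAt_comp_symm he hz hf

variable [IsManifold (𝓡 n) ∞ M]
  {g : Bundle.ContMDiffRiemannianMetric (𝓡 n) ∞ (EuclideanSpace ℝ (Fin n))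
      (fun x : M => TangentSpace (𝓡 n) x)}

/-! ### The metric in charts -/

theorem metricInChart_symm (z : EuclideanSpace ℝ (Fin n)) (i j : Fin n) :
    metricInChart g e z i j = metricInChart g e z j i :=
  g.symm _ _ _

theorem clm_apply₂_eq_sum {V : Type*} [TopologicalSpace V] [AddCommGroup V] [Module ℝ V]
    [IsTopologicalAddGroup V] [ContinuousSMul ℝ V] (B : V →L[ℝ] V →L[ℝ] ℝ)
    (D : EuclideanSpace ℝ (Fin n) →L[ℝ] V) (u v : EuclideanSpace ℝ (Fin n)) :
    B (D u) (D v) = ∑ a, ∑ b, B (D (EuclideanSpace.single a 1)) (D (EuclideanSpace.single b 1))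
      * (u a * v b) := by
  have hD : ∀ v : EuclideanSpace ℝ (Fin n), D v
      = ∑ k, v k • D (EuclideanSpace.single k (1 : ℝ)) := by
    intro v
    have hv : v = ∑ k, v k • EuclideanSpace.single k (1 : ℝ) := by
      have := (EuclideanSpace.basisFun (Fin n) ℝ).sum_repr v
      simpa using this.symm
    conv_lhs => rw [hv]
    simp
  rw [hD u, map_sum, sum_apply]
  refine Finset.sum_congr rfl fun a _ => ?_
  rw [hD v, map_sum]
  refine Finset.sum_congr rfl fun b _ => ?_
  rw [map_smul, map_smul, smul_apply, smul_eq_mul, smul_eq_mul]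
  ring

theorem inner_mfderiv_symm (u v : EuclideanSpace ℝ (Fin n)) :
    g.inner (e.symm y) (mfderiv (𝓡 n) (𝓡 n) e.symm y u) (mfderiv (𝓡 n) (𝓡 n) e.symm y v)
      = ∑ a, ∑ b, metricInChart g e y a b * (u a * v b) := by
  exact clm_apply₂_eq_sum (V := TangentSpace (𝓡 n) (e.symm y)) (g.inner (e.symm y))
    (mfderiv (𝓡 n) (𝓡 n) e.symm y) u v

theorem metricInChart_posDef (he : e ∈ IsManifold.maximalAtlas (𝓡 n) ∞ M) (hy : y ∈ e.target) :
    (metricInChart g e y).PosDef := by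
  have hmd : e.MDifferentiable (𝓡 n) (𝓡 n) :=
    ⟨(contMDiffOn_of_mem_maximalAtlas he).mdifferentiableOn (by simp),
      (contMDiffOn_symm_of_mem_maximalAtlas he).mdifferentiableOn (by simp)⟩
  refine Matrix.PosDef.of_dotProduct_mulVec_pos ?_ fun u hu => ?_
  · ext i j
    exact metricInChart_symm y j i
  · have h1 : (mfderiv (𝓡 n) (𝓡 n) e.symm y (WithLp.toLp 2 u : EuclideanSpace ℝ (Fin n))) ≠ 0 := by
      intro h0
      have := hmd.symm.mfderiv_injective (x := y) hy (h0.trans (map_zero _).symm)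
      exact hu (congrArg WithLp.ofLp this)
    have h2 := g.pos _ _ h1
    rw [inner_mfderiv_symm] at h2
    refine h2.trans_eq ?_
    simp only [dotProduct, Matrix.mulVec, Pi.star_apply, star_trivial, Finset.mul_sum]
    exact Finset.sum_congr rfl fun i _ => Finset.sum_congr rfl fun j _ => by ring

/-- The coordinate fields are images of constant fields under the differential of a smooth map,
hence smooth along the inverse chart; the smooth metric is then evaluated on them. -/
theorem contDiffAt_metricInChart (he : e ∈ IsManifold.maximalAtlas (𝓡 n) ∞ M) (hy : y ∈ e.target)
    (i j : Fin n) : ContDiffAt ℝ ∞ (fun z => metricInChart g e z i j) y := by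
  have hs := contMDiffAt_symm_of_mem_maximalAtlas he hy
  have hv : ∀ i : Fin n, ContMDiffAt (𝓡 n) ((𝓡 n).prod 𝓘(ℝ, EuclideanSpace ℝ (Fin n))) ∞
      (fun z => (Bundle.TotalSpace.mk' (EuclideanSpace ℝ (Fin n))
        (E := fun x : M => TangentSpace (𝓡 n) x) (e.symm z)
        (mfderiv (𝓡 n) (𝓡 n) e.symm z
          (EuclideanSpace.single i (1 : ℝ) : EuclideanSpace ℝ (Fin n))))) y := by
    intro i
    have hc : ContMDiffAt (𝓡 n) ((𝓡 n).prod 𝓘(ℝ, EuclideanSpace ℝ (Fin n))) ∞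
        (fun z : EuclideanSpace ℝ (Fin n) => (Bundle.TotalSpace.mk' (EuclideanSpace ℝ (Fin n))
          (E := fun x : EuclideanSpace ℝ (Fin n) => TangentSpace (𝓡 n) x) z
          (EuclideanSpace.single i (1 : ℝ) : EuclideanSpace ℝ (Fin n)))) y :=
      contMDiffAt_vectorSpace_iff_contDiffAt.2 contDiffAt_const
    exact ContMDiffAt.clm_apply_of_inCoordinates (hs.mfderiv_const (m := ∞) (by simp)) hc hs
  have key := ContMDiffAt.clm_bundle_apply₂ (F₃ := ℝ) (E₃ := Bundle.Trivial M ℝ)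
    (g.contMDiff.contMDiffAt.comp y hs) (hv i) (hv j)
  rw [Bundle.contMDiffAt_totalSpace] at key
  exact contMDiffAt_iff_contDiffAt.1 key.2

/-! ### Charts that are normal at a point -/

/-- Precomposing the inverse of a chart with a map that is a local diffeomorphism at `0`. -/
theorem exists_chart_comp (he : e ∈ IsManifold.maximalAtlas (𝓡 n) ∞ M)
    {Ψ : EuclideanSpace ℝ (Fin n) → EuclideanSpace ℝ (Fin n)} (hΨ : ContDiff ℝ ∞ Ψ)
    (h0 : Ψ 0 ∈ e.target) (hinv : IsUnit (fderiv ℝ Ψ 0)) :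
    ∃ e' ∈ IsManifold.maximalAtlas (𝓡 n) ∞ M, 0 ∈ e'.target ∧
      (∀ z, e'.symm z = e.symm (Ψ z)) ∧ ∀ z ∈ e'.target, Ψ z ∈ e.target := by
  obtain ⟨D, hD⟩ := hinv
  have hfd : HasFDerivAt Ψ ((ContinuousLinearEquiv.ofUnit D :
      EuclideanSpace ℝ (Fin n) ≃L[ℝ] EuclideanSpace ℝ (Fin n)) :
      EuclideanSpace ℝ (Fin n) →L[ℝ] EuclideanSpace ℝ (Fin n)) 0 := by
    have := (hΨ.differentiable (by simp) 0).hasFDerivAt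
    rw [← hD] at this
    exact this
  let V : Set (EuclideanSpace ℝ (Fin n)) := {z | IsUnit (fderiv ℝ Ψ z)}
  have hV : IsOpen V := Units.isOpen.preimage (hΨ.continuous_fderiv (by simp))
  let Φ₀ := hΨ.contDiffAt.toOpenPartialHomeomorph Ψ hfd (by simp)
  have hΦ₀ : (Φ₀ : _ → _) = Ψ := rfl
  -- Restricting to the points where the derivative is invertible makes the local inverse smooth on
  -- its whole domain, as membership in the atlas requires.
  let Φ := Φ₀.restrOpen V hV
  have hΦ : (Φ : _ → _) = Ψ := rfl
  have h0Φ : (0 : EuclideanSpace ℝ (Fin n)) ∈ Φ.source :=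
    ⟨hΨ.contDiffAt.mem_toOpenPartialHomeomorph_source hfd (by simp), ⟨D, hD⟩⟩
  have hsymm : ∀ z ∈ Φ.target, ContDiffAt ℝ ∞ Φ.symm z := by
    intro z hz
    obtain ⟨D', hD'⟩ := (Φ.map_target hz).2
    have hfd' : HasFDerivAt Φ ((ContinuousLinearEquiv.ofUnit D' :
        EuclideanSpace ℝ (Fin n) ≃L[ℝ] EuclideanSpace ℝ (Fin n)) :
        EuclideanSpace ℝ (Fin n) →L[ℝ] EuclideanSpace ℝ (Fin n)) (Φ.symm z) := by
      have := (hΨ.differentiable (by simp) (Φ.symm z)).hasFDerivAt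
      rw [← hD'] at this
      exact this
    exact Φ.contDiffAt_symm hz hfd' hΨ.contDiffAt
  refine ⟨e.trans Φ.symm, ?_, ?_, fun z => rfl, ?_⟩
  · refine OpenPartialHomeomorph.mem_maximalAtlas_of_contMDiffOn _ ?_ ?_
    · intro x hx
      have hx' : x ∈ e.source ∧ e x ∈ Φ.target := by simpa using hx
      exact ((contMDiffAt_iff_contDiffAt.2 (hsymm _ hx'.2)).comp x
        (contMDiffAt_of_mem_maximalAtlas he hx'.1)).contMDiffWithinAt
    · intro z hz
      have hz' : z ∈ Φ.source ∧ Ψ z ∈ e.target := by simpa [hΦ] using hz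
      exact ((contMDiffAt_symm_of_mem_maximalAtlas he hz'.2).comp z
        (contMDiffAt_iff_contDiffAt.2 hΨ.contDiffAt)).contMDiffWithinAt
  · simpa using ⟨h0Φ, h0⟩
  · intro z hz
    have hz' : z ∈ Φ.source ∧ Ψ z ∈ e.target := by simpa [hΦ] using hz
    exact hz'.2

theorem metricInChart_comp (he : e ∈ IsManifold.maximalAtlas (𝓡 n) ∞ M)
    {e' : OpenPartialHomeomorph M (EuclideanSpace ℝ (Fin n))}
    {Ψ : EuclideanSpace ℝ (Fin n) → EuclideanSpace ℝ (Fin n)} (hΨ : ContDiff ℝ ∞ Ψ)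
    (he' : ∀ z, e'.symm z = e.symm (Ψ z)) {z : EuclideanSpace ℝ (Fin n)} (hz : Ψ z ∈ e.target)
    (i j : Fin n) : metricInChart g e' z i j = ∑ a, ∑ b, metricInChart g e (Ψ z) a b
      * (pd i (fun z => Ψ z a) z * pd j (fun z => Ψ z b) z) := by
  have hfun : (e'.symm : EuclideanSpace ℝ (Fin n) → M) = e.symm ∘ Ψ := funext he'
  have hd : ∀ i k, pd i (fun z => Ψ z k) z = (fderiv ℝ Ψ z (EuclideanSpace.single i 1)) k := by
    intro i k
    have := ((EuclideanSpace.proj (𝕜 := ℝ) k).hasFDerivAt.comp z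
      (hΨ.differentiable (by simp) z).hasFDerivAt).fderiv
    change fderiv ℝ ((EuclideanSpace.proj (𝕜 := ℝ) k) ∘ Ψ) z _ = _
    rw [this]
    rfl
  have hm : mfderiv (𝓡 n) (𝓡 n) (e.symm ∘ Ψ) z
      = (mfderiv (𝓡 n) (𝓡 n) e.symm (Ψ z)).comp (fderiv ℝ Ψ z) := by
    rw [mfderiv_comp z ((contMDiffAt_symm_of_mem_maximalAtlas he hz).mdifferentiableAt (by simp))
      (hΨ.differentiable (by simp) z).mdifferentiableAt, mfderiv_eq_fderiv]
    rfl
  simp_rw [hd]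
  rw [← inner_mfderiv_symm]
  simp only [metricInChart, Matrix.of_apply]
  rw [hfun, hm]
  rfl

end Charts

theorem RiemCoord.IsNormalMap.isUnit_fderiv {n : ℕ} {y : EuclideanSpace ℝ (Fin n)}
    {G : EuclideanSpace ℝ (Fin n) → Matrix (Fin n) (Fin n) ℝ}
    {Ψ : EuclideanSpace ℝ (Fin n) → EuclideanSpace ℝ (Fin n)} {A : Matrix (Fin n) (Fin n) ℝ}
    (hΨ : IsNormalMap G y A Ψ) : IsUnit (fderiv ℝ Ψ 0) := by
  have hd : ∀ v k, fderiv ℝ Ψ 0 v k = A.mulVec v.ofLp k := by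
    intro v k
    have h1 := ((EuclideanSpace.proj (𝕜 := ℝ) k).hasFDerivAt.comp 0
      (hΨ.smooth.differentiable (by simp) 0).hasFDerivAt).fderiv
    have h2 : fderiv ℝ (fun z => Ψ z k) 0 v = fderiv ℝ Ψ 0 v k := by
      change fderiv ℝ ((EuclideanSpace.proj (𝕜 := ℝ) k) ∘ Ψ) 0 v = _
      rw [h1]
      rfl
    rw [← h2, fderiv_eq_sum_pd]
    simp_rw [hΨ.pd_eq, Matrix.mulVec, dotProduct, mul_comm]
  have hinj : Function.Injective (fderiv ℝ Ψ 0) := by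
    intro u v huv
    have h1 : A.mulVec u.ofLp = A.mulVec v.ofLp := by
      ext k
      rw [← hd, ← hd, huv]
    exact WithLp.ofLp_injective 2 (Matrix.mulVec_injective_of_isUnit
      ((Matrix.isUnit_iff_isUnit_det _).2 hΨ.isUnit) h1)
  have hsurj : Function.Surjective (fderiv ℝ Ψ 0) :=
    (LinearMap.injective_iff_surjective (f := (fderiv ℝ Ψ 0).toLinearMap)).1 hinj
  exact ContinuousLinearMap.isUnit_iff_bijective.2 ⟨hinj, hsurj⟩

theorem RiemCoord.hessian_neg {n : ℕ} (G : EuclideanSpace ℝ (Fin n) → Matrix (Fin n) (Fin n) ℝ)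
    (F : EuclideanSpace ℝ (Fin n) → ℝ) (i j : Fin n) (y : EuclideanSpace ℝ (Fin n)) :
    hessian G (fun z => -F z) i j y = -hessian G F i j y := by
  have h : ∀ k, pd k (fun z => -F z) = fun z => -pd k F z := fun k => funext fun z => pd_neg k
  simp only [hessian, h, pd_neg, mul_neg, Finset.sum_neg_distrib]
  ring

/-! ### Global argument on the manifold -/

section Manifold

variable {n : ℕ} {M : Type*} [TopologicalSpace M] [ChartedSpace (EuclideanSpace ℝ (Fin n)) M]
  [IsManifold (𝓡 n) ∞ M]
  {g : Bundle.ContMDiffRiemannianMetric (𝓡 n) ∞ (EuclideanSpace ℝ (Fin n))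
      (fun x : M => TangentSpace (𝓡 n) x)}
  {e : OpenPartialHomeomorph M (EuclideanSpace ℝ (Fin n))} {y : EuclideanSpace ℝ (Fin n)}
  {m s : ℝ} {f lam : M → ℝ}

theorem smoothNear_metricInChart (he : e ∈ IsManifold.maximalAtlas (𝓡 n) ∞ M) (hy : y ∈ e.target)
    (i j : Fin n) : SmoothNear (fun z => metricInChart g e z i j) y := by
  filter_upwards [e.open_target.mem_nhds hy] with z hz using contDiffAt_metricInChart he hz i j

theorem isUnit_det_metricInChart (he : e ∈ IsManifold.maximalAtlas (𝓡 n) ∞ M)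
    (hy : y ∈ e.target) : IsUnit (metricInChart g e y).det :=
  (Matrix.isUnit_iff_isUnit_det _).1 (metricInChart_posDef he hy).isUnit

/-- Around every point there is a chart that is normal to first order at this point. -/
theorem exists_normal_chart (g : Bundle.ContMDiffRiemannianMetric (𝓡 n) ∞
      (EuclideanSpace ℝ (Fin n)) (fun x : M => TangentSpace (𝓡 n) x))
    (he : e ∈ IsManifold.maximalAtlas (𝓡 n) ∞ M) (hy : y ∈ e.target) :
    ∃ A Ψ, IsNormalMap (metricInChart g e) y A Ψ ∧ ∃ e' ∈ IsManifold.maximalAtlas (𝓡 n) ∞ M,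
      0 ∈ e'.target ∧ (∀ z, e'.symm z = e.symm (Ψ z)) ∧ IsNormalAt (metricInChart g e') 0 := by
  obtain ⟨A, Ψ, hΨ⟩ := exists_isNormalMap (G := metricInChart g e)
    (fun z i j => metricInChart_symm z i j) (metricInChart_posDef he hy)
  obtain ⟨e', he', h0, hsymm, htarget⟩ := exists_chart_comp he hΨ.smooth
    (by rwa [hΨ.map_zero]) hΨ.isUnit_fderiv
  refine ⟨A, Ψ, hΨ, e', he', h0, hsymm, hΨ.isNormalAt (smoothNear_metricInChart he hy)
    (fun z i j => metricInChart_symm z i j) (fun z i j => metricInChart_symm z i j) ?_⟩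
  filter_upwards [e'.open_target.mem_nhds h0] with z hz i j
    using metricInChart_comp he hΨ.smooth hsymm (htarget z hz) i j

namespace IsGeneralizedEinstein

theorem neg (hE : IsGeneralizedEinstein m g f lam) :
    IsGeneralizedEinstein m g (fun x => -f x) lam where
  m_pos := hE.m_pos
  smooth_f := hE.smooth_f.neg
  smooth_lam := hE.smooth_lam
  equation e he y hy i j := by
    rw [hessian_neg, hE.equation e he y hy i j]
    ring

theorem einsteinNear (hE : IsGeneralizedEinstein m g f lam) (hs : HasConstantScalarCurvature g s)
    (he : e ∈ IsManifold.maximalAtlas (𝓡 n) ∞ M) (hy : y ∈ e.target) :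
    EinsteinNear (metricInChart g e) (fun z => f (e.symm z)) (fun z => lam (e.symm z)) m s y where
  smooth_F := smoothNear_comp_symm he hy hE.smooth_f
  smooth_L := smoothNear_comp_symm he hy hE.smooth_lam
  equation := by
    filter_upwards [e.open_target.mem_nhds hy] with z hz i j using hE.equation e he z hz i j
  scalar_eq := by
    filter_upwards [e.open_target.mem_nhds hy] with z hz using hs e he z hz

/-- Each point is treated with its own normal chart. The identity therefore holds in one fixed chart
wherever `f` does not vanish, and can be differentiated there. -/
theorem ricci_grad (hE : IsGeneralizedEinstein m g f lam) (hs : HasConstantScalarCurvature g s)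
    (he : e ∈ IsManifold.maximalAtlas (𝓡 n) ∞ M) (hy : y ∈ e.target) (hf : f (e.symm y) ≠ 0)
    (j : Fin n) :
    (m - 1) * ∑ a, ricci (metricInChart g e) j a y
        * ∑ b, (metricInChart g e y)⁻¹ a b * pd b (fun z => f (e.symm z)) y
      = pd j (fun z => (((n : ℝ) - 1) * lam (e.symm z) - s) * f (e.symm z)) y := by
  obtain ⟨A, Ψ, hΨ, e', he', h0, hsymm, hN⟩ := exists_normal_chart g he hy
  have hE' := hE.einsteinNear hs he' h0
  simp only [hsymm] at hE'
  exact hΨ.ricci_grad (F := fun z => f (e.symm z)) (L := fun z => lam (e.symm z)) hN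
    (hE.einsteinNear hs he hy) hE' hE.m_pos.ne' hf (isUnit_det_metricInChart he hy) j

theorem superharmonic (hE : IsGeneralizedEinstein m g f lam)
    (hs : HasConstantScalarCurvature g s) (hm : 1 < m)
    (he : e ∈ IsManifold.maximalAtlas (𝓡 n) ∞ M) (hy : y ∈ e.target) (hf : 0 < f (e.symm y)) :
    laplacian (metricInChart g e) (fun z => ((n + m - 1) * s - n * ((n : ℝ) - 1)
      * lam (e.symm z)) * f (e.symm z)) y ≤ 0 := by
  obtain ⟨A, Ψ, hΨ, e', he', h0, hsymm, hN⟩ := exists_normal_chart g he hy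
  have hF := smoothNear_comp_symm he hy hE.smooth_f
  have hL := smoothNear_comp_symm he hy hE.smooth_lam
  have hf0 : 0 < f (e'.symm 0) := by rwa [hsymm, hΨ.map_zero]
  rw [laplacian, ← hΨ.sum_pd_pd_comp_eq
    (((SmoothNear.const _).sub ((SmoothNear.const _).mul hL)).mul hF)]
  -- Near the centre `f` remains positive, so the gradient identity is available on a neighbourhood.
  have key := hN.superharmonic (hE.einsteinNear hs he' h0) hm hf0 (by
    filter_upwards [e'.open_target.mem_nhds h0,
      (contDiffAt_comp_symm he' h0 hE.smooth_f).continuousAt.eventually (lt_mem_nhds hf0)]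
      with z hz hfz j using hE.ricci_grad hs he' hz hfz.ne' j)
  simpa only [hsymm] using key

theorem laplacian_eq (hE : IsGeneralizedEinstein m g f lam) (hs : HasConstantScalarCurvature g s)
    (he : e ∈ IsManifold.maximalAtlas (𝓡 n) ∞ M) (hy : y ∈ e.target) :
    laplacian (metricInChart g e) (fun z => f (e.symm z)) y
      = f (e.symm y) / m * (s - n * lam (e.symm y)) := by
  have htr : ∑ i, ∑ j, (metricInChart g e y)⁻¹ i j * metricInChart g e y i j = n := by
    have h := congrArg Matrix.trace
      (Matrix.nonsing_inv_mul (metricInChart g e y) (isUnit_det_metricInChart he hy))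
    rw [Matrix.trace_one, Fintype.card_fin] at h
    rw [← h]
    exact Finset.sum_congr rfl fun i _ => Finset.sum_congr rfl fun j _ => by
      rw [metricInChart_symm]
  rw [← htr, ← hs e he y hy]
  simp only [laplacian, hE.equation e he y hy, scalar, Finset.mul_sum, Finset.sum_mul,
    ← Finset.sum_sub_distrib]
  exact Finset.sum_congr rfl fun i _ => Finset.sum_congr rfl fun j _ => by ring

end IsGeneralizedEinstein

/-- The maximum principle on the set where `f` is positive. -/
theorem nonpos_of_subharmonic [CompactSpace M] [ConnectedSpace M] {v : M → ℝ}
    (hf : Continuous f) (hv : ContMDiff (𝓡 n) 𝓘(ℝ, ℝ) ∞ v) (hzero : ∃ x, f x = 0)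
    (hv0 : ∀ x, f x = 0 → v x ≤ 0)
    (hL : ∀ e ∈ IsManifold.maximalAtlas (𝓡 n) ∞ M, ∀ y ∈ e.target, 0 < f (e.symm y) →
      0 ≤ laplacian (metricInChart g e) (fun z => v (e.symm z)) y) {x : M} (hx : 0 < f x) :
    v x ≤ 0 := by
  by_contra! hvx
  have hvc := hv.continuous
  obtain ⟨p, hp, hmax⟩ := (isClosed_le continuous_const hf).isCompact.exists_isMaxOn
    (s := {x | 0 ≤ f x}) ⟨x, hx.le⟩ hvc.continuousOn
  have hpos : 0 < v p := hvx.trans_le (hmax (a := x) hx.le)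
  -- `Z` is open: its points have `f > 0`, since `v ≤ 0` on the zero set, and there the strong
  -- maximum principle applies. By connectedness `Z` would be all of `M`, yet it contains no zero of
  -- `f`.
  let Z : Set M := {q | 0 ≤ f q ∧ v q = v p}
  have hclosed : IsClosed Z :=
    (isClosed_le continuous_const hf).inter (isClosed_eq hvc continuous_const)
  have hopen : IsOpen Z := by
    refine isOpen_iff_mem_nhds.2 fun q hq => ?_
    have hfq : 0 < f q := by
      refine lt_of_le_of_ne hq.1 fun h => ?_
      have := hv0 q h.symm
      rw [hq.2] at this
      linarith
    set e := chartAt (EuclideanSpace ℝ (Fin n)) q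
    have he : e ∈ IsManifold.maximalAtlas (𝓡 n) ∞ M := IsManifold.chart_mem_maximalAtlas q
    have hqs : q ∈ e.source := mem_chart_source _ q
    have hqe : e.symm (e q) = q := e.left_inv hqs
    let U := e.target ∩ e.symm ⁻¹' {x | 0 < f x}
    have hU : IsOpen U := e.symm.isOpen_inter_preimage (isOpen_lt continuous_const hf)
    have hqU : e q ∈ U := ⟨e.map_source hqs, by simpa [hqe] using hfq⟩
    have h1 := eventually_eq_of_subharmonic (G := metricInChart g e)
      (F := fun z => v (e.symm z)) (c := v p) hU (fun z i j => metricInChart_symm z i j)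
      (fun z hz i j => contDiffAt_metricInChart he hz.1 i j)
      (fun z hz => metricInChart_posDef he hz.1) (fun z hz => contDiffAt_comp_symm he hz.1 hv)
      (fun z hz => hmax (show 0 ≤ f (e.symm z) from le_of_lt hz.2)) (fun z hz => hL e he z hz.1 hz.2) hqU
      (by rw [hqe]; exact hq.2)
    filter_upwards [(e.continuousAt hqs).eventually h1, e.open_source.mem_nhds hqs,
      hf.continuousAt.eventually (lt_mem_nhds hfq)] with r hr1 hr2 hr3
    rw [e.left_inv hr2] at hr1
    exact ⟨hr3.le, hr1⟩
  have huniv := IsClopen.eq_univ ⟨hclosed, hopen⟩ ⟨p, hp, rfl⟩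
  obtain ⟨q, hq⟩ := hzero
  have hqZ : q ∈ Z := huniv ▸ Set.mem_univ q
  have := hv0 q hq
  rw [hqZ.2] at this
  linarith

theorem IsGeneralizedEinstein.scalar_pos_of_exists_pos [CompactSpace M] [ConnectedSpace M]
    (hn : 2 ≤ n) (hm : 1 < m) (hE : IsGeneralizedEinstein m g f lam)
    (hs : HasConstantScalarCurvature g s) (hzero : ∃ x, f x = 0) (hpos : ∃ x, 0 < f x) :
    0 < s := by
  by_contra! hs0
  have hn' : (2 : ℝ) ≤ n := by exact_mod_cast hn
  -- First use of the maximum principle, applied to the negative of the superharmonic function.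
  have hw : ∀ x, 0 < f x → 0 ≤ ((n + m - 1) * s - n * ((n : ℝ) - 1) * lam x) * f x := by
    intro x hx
    have hsm : ContMDiff (𝓡 n) 𝓘(ℝ, ℝ) ∞ fun x =>
        ((n + m - 1) * s - n * ((n : ℝ) - 1) * lam x) * f x :=
      (contMDiff_const.sub (contMDiff_const.mul hE.smooth_lam)).mul hE.smooth_f
    have h := nonpos_of_subharmonic (g := g)
      (v := fun x => (-1) * (((n + m - 1) * s - n * ((n : ℝ) - 1) * lam x) * f x))
      hE.smooth_f.continuous (contMDiff_const.mul hsm) hzero (fun x hx => by simp [hx])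
      (fun e he y hy hfy => by
        rw [laplacian_const_mul (-1) (smoothNear_comp_symm he hy hsm)]
        linarith [hE.superharmonic hs hm he hy hfy]) hx
    linarith
  obtain ⟨x, hx⟩ := hpos
  -- Second use, applied to `f` itself, which is subharmonic where it is positive once `s ≤ 0`.
  refine not_le.2 hx (nonpos_of_subharmonic (g := g) hE.smooth_f.continuous hE.smooth_f hzero
    (fun x hx => hx.le) (fun e he y hy hfy => ?_) hx)
  rw [hE.laplacian_eq hs he hy]
  have h1 := nonneg_of_mul_nonneg_left (hw _ hfy) hfy
  -- The right side equals ((n + m - 1)s - n(n - 1)λ) - ms, a sum of two nonnegative terms.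
  have h2 : 0 ≤ ((n : ℝ) - 1) * (s - n * lam (e.symm y)) := by nlinarith
  have h3 := nonneg_of_mul_nonneg_right h2 (by linarith)
  exact mul_nonneg (div_nonneg hfy.le hE.m_pos.le) h3

end Manifold

theorem mainTheorem9 {n : ℕ} (hn : 2 ≤ n) {M : Type*} [TopologicalSpace M] [T2Space M]
    [CompactSpace M] [ConnectedSpace M] [ChartedSpace (EuclideanSpace ℝ (Fin n)) M]
    [IsManifold (𝓡 n) ∞ M]
    (g : Bundle.ContMDiffRiemannianMetric (𝓡 n) ∞ (EuclideanSpace ℝ (Fin n))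
      (fun x : M => TangentSpace (𝓡 n) x))
    (m : ℝ) (hm : 1 < m) (f lam : M → ℝ) (hE : IsGeneralizedEinstein m g f lam)
    (hzero : (f ⁻¹' {0}).Nonempty) (hf : ∃ x, f x ≠ 0)
    (s : ℝ) (hs : HasConstantScalarCurvature g s) :
    0 < s := by
  obtain ⟨p, hp⟩ := hzero
  obtain ⟨x, hx⟩ := hf
  rcases hx.lt_or_gt with h | h
  · exact hE.neg.scalar_pos_of_exists_pos hn hm hs ⟨p, by simpa using hp⟩ ⟨x, by simpa using h⟩
  · exact hE.scalar_pos_of_exists_pos hn hm hs ⟨p, hp⟩ ⟨x, h⟩
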